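/- Let $\mathcal A$ be a finite alphabet, $\mathcal A^*$ the free monoid of finite words over $\mathcal A$ (with empty word $\varepsilon$ and length $|\cdot|$), and let $G$ be a finite group (under composition) of bijections of $\mathcal A^*$, each of which is a morphism ($\varphi(vw)=\varphi(v)\varphi(w)$) or an antimorphism ($\varphi(vw)=\varphi(w)\varphi(v)$), containing at least one antimorphism. Put $[w]=\{\mu(w):\mu\in G\}$. A word $w$ is a *$G$-palindrome* if $\Theta(w)=w$ for some antimorphism $\Theta\in G$. A *$G$-occurrence* of $w$ in $v$ is an index at which some element of $[w]$ occurs in $v$; $w$ is *$G$-unioccurrent* in $v$ if $w$ occurs in $v$ and has no other $G$-occurrence in $v$. The *$G$-longest palindromic suffix* of $v$ is its longest suffix (possibly $\varepsilon$) that is a $G$-palindrome. Let $\mathbf u\in\mathcal A^{\mathbb N}$ be an infinite word whose language $\mathcal L(\mathbf u)$ (the set of its finite factors) is closed under $G$: $\mu(w)\in\mathcal L(\mathbf u)$ for all $w\in\mathcal L(\mathbf u)$, $\mu\in G$. A factor $w$ is *special* if at least two letters $a$ satisfy $aw\in\mathcal L(\mathbf u)$ or at least two letters $a$ satisfy $wa\in\mathcal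 L(\mathbf u)$. The *graph of symmetries* $\Gamma_n(\mathbf u)$ is the undirected multigraph whose vertices are the classes $[w]$ of special factors $w$ of length $n$, and whose edges are the classes $[e]$ of factors $e$ with $|e|\ge n+1$ whose prefix and suffix of length $n$ are special while no other occurrence of a factor of length $n$ in $e$ is special; the edge $[e]$ joins the class of the prefix of $e$ of length $n$ to the class of its suffix of length $n$. The word $\mathbf u$ has *Property $G$-tls$(N)$* if for every $n\ge N$: $\mathcal L(\mathbf u)$ is closed under $G$; $e$ is a $G$-palindrome for every loop $[e]$ of $\Gamma_n(\mathbf u)$; and the multigraph obtained from $\Gamma_n(\mathbf u)$ by removing loops is a tree (the graph without vertices being counted as a tree). It is *$G$-rich* if it has Property $G$-tls$(1)$, and *almost $G$-rich* if it has Property $G$-tls$(N)$ for some $N\in\mathbb N$. It has *Property $G$-lps$(N)$* if for every $v\in\mathcal L(\mathbf u)$ with $|v|\ge N$ the $G$-longest palindromic suffix of $v$ is $G$-unioccurrent in $v$, or $v$ is nonempty and its last letter is $G$-unioccurrent in $v$. It is *uniformly recurrent* if every factor $w$ has only finitely many return words, i.e. finitely many words $q$ such that $qw\in\mathcal L(\mathbf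 u)$ and $w$ has exactly two occurrences in $qw$, one as a prefix and one as a suffix. **Theorem.** 1. $\mathbf u$ is $G$-rich if and only if $\mathbf u$ has Property $G$-lps$(1)$. 2. If $\mathbf u$ is uniformly recurrent, then $\mathbf u$ is almost $G$-rich if and only if there exists $N\in\mathbb N$ such that $\mathbf u$ has Property $G$-lps$(N)$. -/

import Mathlib

namespace GRich

/-! Finite words over the alphabet `A` are lists, infinite words are functions `ℕ → A`. -/

/-- A morphism of the free monoid of finite words. -/
def IsMorphism {A : Type*} (f : List A → List A) : Prop :=
  ∀ v w : List A, f (v ++ w) = f v ++ f w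

/-- An antimorphism of the free monoid of finite words. -/
def IsAntimorphism {A : Type*} (f : List A → List A) : Prop :=
  ∀ v w : List A, f (v ++ w) = f w ++ f v

/-- The language (set of all finite factors) of an infinite word. -/
def language {A : Type*} (u : ℕ → A) : Set (List A) :=
  {w | ∃ i : ℕ, w = (List.range w.length).map (fun k => u (i + k))}

/-- The index `i` is an occurrence of the finite word `w` in the finite word `v`. -/
def IsOccurrence {A : Type*} (w v : List A) (i : ℕ) : Prop :=
  ∃ s t : List A, v = s ++ w ++ t ∧ s.length = i

/-- `v` is a complete return word of `w` in `u`: a factor of `u` in which `w` occurs exactly twice,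
as a prefix and as a suffix. -/
def IsCompleteReturnWord {A : Type*} (u : ℕ → A) (w v : List A) : Prop :=
  v ∈ language u ∧ w.length < v.length ∧
    ∀ i : ℕ, IsOccurrence w v i ↔ i = 0 ∨ i = v.length - w.length

/-- `q` is a return word of `w` in `u`. -/
def IsReturnWord {A : Type*} (u : ℕ → A) (w q : List A) : Prop :=
  IsCompleteReturnWord u w (q ++ w)

/-- Every factor of `u` has only finitely many return words. -/
def IsUniformlyRecurrent {A : Type*} (u : ℕ → A) : Prop :=
  ∀ w ∈ language u, {q : List A | IsReturnWord u w q}.Finite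

/-- The set of left extensions of `w` in `u`. -/
def leftExtensions {A : Type*} (u : ℕ → A) (w : List A) : Set A :=
  {a | a :: w ∈ language u}

/-- The set of right extensions of `w` in `u`. -/
def rightExtensions {A : Type*} (u : ℕ → A) (w : List A) : Set A :=
  {a | w ++ [a] ∈ language u}

/-- `w` is a left special or right special factor of `u`: it has at least two left extensions or
at least two right extensions. -/
def IsSpecial {A : Type*} (u : ℕ → A) (w : List A) : Prop :=
  w ∈ language u ∧ ((leftExtensions u w).Nontrivial ∨ (rightExtensions u w).Nontrivial)

/-- The class `[w] = {μ(w) | μ ∈ G}`. -/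
def orbit {A : Type*} (G : Subgroup (Equiv.Perm (List A))) (w : List A) : Set (List A) :=
  {x | ∃ μ ∈ G, x = μ w}

/-- The language of `u` is closed under `G`. -/
def IsClosedUnder {A : Type*} (G : Subgroup (Equiv.Perm (List A))) (u : ℕ → A) : Prop :=
  ∀ w ∈ language u, ∀ μ ∈ G, μ w ∈ language u

/-- `w` is a `G`-palindrome: it is fixed by some antimorphism belonging to `G`. -/
def IsPalindrome {A : Type*} (G : Subgroup (Equiv.Perm (List A))) (w : List A) : Prop :=
  ∃ Θ ∈ G, IsAntimorphism Θ ∧ Θ w = w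

/-! ### Graphs of symmetries -/

/-- The vertices of the graphs of symmetries of order `n`: the classes of the special factors of
length `n`. -/
def vertices {A : Type*} (G : Subgroup (Equiv.Perm (List A))) (u : ℕ → A) (n : ℕ) :
    Set (Set (List A)) :=
  {x | ∃ w : List A, w.length = n ∧ IsSpecial u w ∧ x = orbit G w}

/-- The factor `e` is an edge from `x` to `y` in the directed graph of symmetries of order `n`: its
prefix of length `n` belongs to `x`, its suffix of length `n` belongs to `y`, its length is at least
`n + 1`, and special factors of length `n` occur in `e` exactly as this prefix and this suffix. -/
def IsDirectedEdge {A : Type*} (G : Subgroup (Equiv.Perm (List A))) (u : ℕ → A) (n : ℕ)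
    (e : List A) (x y : Set (List A)) : Prop :=
  e ∈ language u ∧ n + 1 ≤ e.length ∧
  x ∈ vertices G u n ∧ y ∈ vertices G u n ∧
  e.take n ∈ x ∧ e.drop (e.length - n) ∈ y ∧
  ∀ i : ℕ, i ≤ e.length - n →
    (IsSpecial u ((e.drop i).take n) ↔ i = 0 ∨ i = e.length - n)

/-- In the undirected graph of symmetries of order `n` (a multigraph, whose edges are classes
`c = [e]` of edges `e` of the directed graph), the edge `c` joins the vertices `x` and `y`. -/
def IsUndirectedEdge {A : Type*} (G : Subgroup (Equiv.Perm (List A))) (u : ℕ → A) (n : ℕ)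
    (c : Set (List A)) (x y : Set (List A)) : Prop :=
  ∃ e : List A, c = orbit G e ∧ (IsDirectedEdge G u n e x y ∨ IsDirectedEdge G u n e y x)

/-- The simple graph underlying the undirected graph of symmetries of order `n` (loops removed,
multiplicities of edges forgotten). -/
def underlyingGraph {A : Type*} (G : Subgroup (Equiv.Perm (List A))) (u : ℕ → A) (n : ℕ) :
    SimpleGraph (vertices G u n) where
  Adj x y := x ≠ y ∧ ∃ c : Set (List A), IsUndirectedEdge G u n c x y
  symm := ⟨by
    rintro x y ⟨hxy, c, e, hc, he⟩
    exact ⟨hxy.symm, c, e, hc, he.symm⟩⟩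
  loopless := ⟨fun _ h => h.1 rfl⟩

/-- The multigraph obtained from the undirected graph of symmetries of order `n` by removing loops
is a tree: it has no multiple edges, and the underlying simple graph is connected and has no
cycles. The graph without vertices, which arises when `u` is periodic and has no special factor of
length `n`, counts as a tree. -/
def IsTreeWithoutLoops {A : Type*} (G : Subgroup (Equiv.Perm (List A))) (u : ℕ → A) (n : ℕ) :
    Prop :=
  (∀ x y : Set (List A), x ≠ y → ∀ c d : Set (List A),
    IsUndirectedEdge G u n c x y → IsUndirectedEdge G u n d x y → c = d) ∧
  (underlyingGraph G u n).Preconnected ∧ (underlyingGraph G u n).IsAcyclic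

/-- Property `G`-tls(`N`) (tree-like structure). -/
def PropertyTls {A : Type*} (G : Subgroup (Equiv.Perm (List A))) (u : ℕ → A) (N : ℕ) : Prop :=
  ∀ n : ℕ, N ≤ n →
    IsClosedUnder G u ∧
    (∀ (x : Set (List A)) (e : List A), IsDirectedEdge G u n e x x → IsPalindrome G e) ∧
    IsTreeWithoutLoops G u n

/-- `u` is `G`-rich. -/
def IsRich {A : Type*} (G : Subgroup (Equiv.Perm (List A))) (u : ℕ → A) : Prop :=
  PropertyTls G u 1

/-- `u` is almost `G`-rich. -/
def IsAlmostRich {A : Type*} (G : Subgroup (Equiv.Perm (List A))) (u : ℕ → A) : Prop :=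
  ∃ N : ℕ, PropertyTls G u N

/-! ### Longest palindromic suffixes -/

/-- The index `i` is a `G`-occurrence of `w` in `v`. -/
def IsGOccurrence {A : Type*} (G : Subgroup (Equiv.Perm (List A))) (w v : List A) (i : ℕ) : Prop :=
  ∃ w' ∈ orbit G w, IsOccurrence w' v i

/-- `w` is `G`-unioccurrent in `v`: it occurs in `v` and has no other `G`-occurrence in `v`. -/
def IsUnioccurrent {A : Type*} (G : Subgroup (Equiv.Perm (List A))) (w v : List A) : Prop :=
  ∃ i : ℕ, IsOccurrence w v i ∧ ∀ j : ℕ, IsGOccurrence G w v j → j = i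

/-- `x` is the `G`-longest palindromic suffix of `v` (possibly the empty word). -/
def IsLongestPalindromicSuffix {A : Type*} (G : Subgroup (Equiv.Perm (List A)))
    (v x : List A) : Prop :=
  x <:+ v ∧ IsPalindrome G x ∧
    ∀ x' : List A, x' <:+ v → IsPalindrome G x' → x'.length ≤ x.length

/-- Property `G`-lps(`N`): for each factor `v` of length at least `N`, the `G`-longest palindromic
suffix of `v` is `G`-unioccurrent in `v`, or the last letter of `v` is `G`-unioccurrent in `v`. -/
def PropertyLps {A : Type*} (G : Subgroup (Equiv.Perm (List A))) (u : ℕ → A) (N : ℕ) : Prop :=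
  ∀ v ∈ language u, N ≤ v.length →
    (∃ x : List A, IsLongestPalindromicSuffix G v x ∧ IsUnioccurrent G x v) ∨
    (∃ a : A, v.getLast? = some a ∧ IsUnioccurrent G [a] v)

end GRich

/-!
Both properties are compared with a third one: for every `n ≥ N`, all complete `G`-return words of
factors of length `n` are `G`-palindromes (`PalindromicReturns`). A complete `G`-return word is
encoded by two consecutive indices at which `u` has factors of length `n` of the same class. The
language being closed under an antimorphism, `u` is recurrent (`IsSymmetric.recurrent`).

*Palindromic returns give the tree-like structure.* Loops are complete `G`-return words. For two
classes `x ≠ y`, call a factor between two consecutive visits of `u` to `x ∪ y`, one to `x` and one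
to `y`, a switch. The complete `G`-return word of `x` that starts with a switch is a
`G`-palindrome, so the next switch is an image of the first one; hence all switches between `x` and
`y` lie in one class (`IsSymmetric.orbit_switch_eq`), and there are no multiple edges. If `x` and
`y` are joined by an edge, each other vertex occurs in `u` between two consecutive visits to `x`, or
between two consecutive visits to `y`; by palindromicity the same alternative holds at all its
occurrences (`IsSymmetric.onSide_of_cls_eq`). So the edge is a bridge, and the graph has no cycles.

*The tree-like structure gives palindromic returns.* A complete `G`-return word of a special factor
is a closed walk in a tree with loops that does not come back to its starting point before its end:
it is a loop, or its first and last edges coincide. So an antimorphism of `G` exchanges a prefix and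
a suffix longer than the special factor (`IsSymmetric.exists_antimorphism_of_isSpecial`). Consider
the longest prefix of a complete `G`-return word that an antimorphism exchanges with a suffix. If it
is a proper prefix, it is special, and an application of the above to this prefix, at a higher order
of the graph, contradicts maximality. What remains is to find some such prefix, of length at least
`n`. If there is none, then the given factor and all its symmetric extensions are not special, which
forces `u` to continue by images of the return word under morphisms; but an image of the factor
under an antimorphism has to occur as well (`IsSymmetric.not_isDirectReturn`).

*Palindromic returns and longest palindromic suffixes.* If the longest `G`-palindromic suffix were
not `G`-unioccurrent, the complete `G`-return word at the end would be a longer one. Conversely, in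
a complete `G`-return word a `G`-unioccurrent `G`-palindromic suffix is longer than the factor that
returns, and then has to be the whole word. Uniform recurrence is needed only to make sure that the
longest `G`-palindromic suffix of a long factor is long.
-/

namespace GRich

variable {A : Type*} {G : Subgroup (Equiv.Perm (List A))} {u : ℕ → A}

/-! ### Factors of an infinite word -/

/-- The factor of length `n` of the infinite word `u` starting at the index `i`. -/
def factor (u : ℕ → A) (i n : ℕ) : List A := (List.range n).map (fun k => u (i + k))

@[simp] theorem length_factor (u : ℕ → A) (i n : ℕ) : (factor u i n).length = n := by
  simp [factor]

theorem factor_add (u : ℕ → A) (i m n : ℕ) :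
    factor u i (m + n) = factor u i m ++ factor u (i + m) n := by
  simp [factor, List.range_add, add_assoc]

theorem factor_one (u : ℕ → A) (i : ℕ) : factor u i 1 = [u i] := by
  simp [factor]

theorem factor_mem_language (u : ℕ → A) (i n : ℕ) : factor u i n ∈ language u :=
  ⟨i, by simp [factor]⟩

theorem exists_eq_factor {w : List A} (h : w ∈ language u) : ∃ i, w = factor u i w.length := h

theorem take_drop_factor (u : ℕ → A) (i a b c : ℕ) :
    ((factor u i (a + b + c)).drop a).take b = factor u (i + a) b := by
  rw [factor_add, factor_add, List.append_assoc, List.drop_left' (by simp),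
    List.take_left' (by simp)]

theorem factor_eq_of_factor_eq {i j m : ℕ} (h : factor u i m = factor u j m) (a b : ℕ)
    (hab : a + b ≤ m) : factor u (i + a) b = factor u (j + a) b := by
  obtain ⟨c, rfl⟩ := Nat.exists_eq_add_of_le hab
  rw [← take_drop_factor u i a b c, h, take_drop_factor]

theorem eq_factor_of_append_eq {s w t : List A} {i m : ℕ} (h : factor u i m = s ++ w ++ t) :
    w = factor u (i + s.length) w.length := by
  have hm : m = s.length + w.length + t.length := by
    simpa [add_assoc] using congrArg List.length h
  subst hm
  rw [← take_drop_factor u i s.length w.length t.length, h, List.append_assoc,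
    List.drop_left, List.take_left]

theorem isOccurrence_factor_iff {w : List A} {i m k : ℕ} :
    IsOccurrence w (factor u i m) k ↔ k + w.length ≤ m ∧ w = factor u (i + k) w.length := by
  constructor
  · rintro ⟨s, t, h, rfl⟩
    refine ⟨?_, eq_factor_of_append_eq h⟩
    have := congrArg List.length h
    simp at this
    omega
  · rintro ⟨hk, hw⟩
    obtain ⟨c, rfl⟩ := Nat.exists_eq_add_of_le hk
    refine ⟨factor u i k, factor u (i + (k + w.length)) c, ?_, by simp⟩
    rw [factor_add, factor_add, ← hw]

/-- A factor that is not special has only one right extension. -/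
theorem factor_succ_eq_of_not_isSpecial {i j n : ℕ} (h : ¬ IsSpecial u (factor u i n))
    (e : factor u i n = factor u j n) : factor u i (n + 1) = factor u j (n + 1) := by
  rw [factor_add, factor_add, factor_one, factor_one, ← e]
  by_contra hne
  refine h ⟨factor_mem_language _ _ _, Or.inr ⟨u (i + n), ?_, u (j + n), ?_, ?_⟩⟩
  · change factor u i n ++ [u (i + n)] ∈ language u
    rw [← factor_one, ← factor_add]
    exact factor_mem_language _ _ _
  · change factor u i n ++ [u (j + n)] ∈ language u
    rw [e, ← factor_one, ← factor_add]
    exact factor_mem_language _ _ _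
  · intro h'
    exact hne (by rw [h'])

theorem factor_succ' (u : ℕ → A) (i n : ℕ) :
    factor u i (n + 1) = u i :: factor u (i + 1) n := by
  rw [add_comm, factor_add, factor_one, List.singleton_append]

/-- A factor that is not special has only one left extension. -/
theorem factor_succ_eq_of_not_isSpecial' {i j n : ℕ} (h : ¬ IsSpecial u (factor u (i + 1) n))
    (e : factor u (i + 1) n = factor u (j + 1) n) : factor u i (n + 1) = factor u j (n + 1) := by
  rw [factor_succ', factor_succ', ← e]
  by_contra hne
  refine h ⟨factor_mem_language _ _ _, Or.inl ⟨u i, ?_, u j, ?_, ?_⟩⟩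
  · change u i :: factor u (i + 1) n ∈ language u
    rw [← factor_succ']
    exact factor_mem_language _ _ _
  · change u j :: factor u (i + 1) n ∈ language u
    rw [e, ← factor_succ']
    exact factor_mem_language _ _ _
  · intro h'
    exact hne (by rw [h'])

/-! ### Symmetries -/

theorem IsMorphism.inv {μ : Equiv.Perm (List A)} (h : IsMorphism μ) :
    IsMorphism (μ⁻¹ : Equiv.Perm (List A)) := fun v w => μ.injective (by
  rw [h]; simp)

theorem IsAntimorphism.inv {μ : Equiv.Perm (List A)} (h : IsAntimorphism μ) :
    IsAntimorphism (μ⁻¹ : Equiv.Perm (List A)) := fun v w => μ.injective (by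
  rw [h]; simp)

theorem IsMorphism.mul {μ ν : Equiv.Perm (List A)} (h : IsMorphism μ) (h' : IsMorphism ν) :
    IsMorphism (μ * ν : Equiv.Perm (List A)) := fun v w => by
  simp [h' v w, h (ν v) (ν w)]

theorem IsMorphism.mul_antimorphism {μ ν : Equiv.Perm (List A)} (h : IsMorphism μ)
    (h' : IsAntimorphism ν) : IsAntimorphism (μ * ν : Equiv.Perm (List A)) := fun v w => by
  simp [h' v w, h (ν w) (ν v)]

theorem length_le_length_apply {f : List A → List A} (hf : Function.Injective f)
    (h : IsMorphism f ∨ IsAntimorphism f) (w : List A) : w.length ≤ (f w).length := by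
  have h0 : f [] = [] := by
    rcases h with h | h <;> simpa using h [] []
  have h1 (a : A) : 1 ≤ (f [a]).length := by
    rw [Nat.one_le_iff_ne_zero, Ne, List.length_eq_zero_iff]
    intro h'
    simpa using hf (h'.trans h0.symm)
  induction w with
  | nil => simp
  | cons a w ih =>
    have := h1 a
    rw [← List.singleton_append]
    rcases h with h | h <;> rw [h] <;> simp <;> omega

theorem length_apply {μ : Equiv.Perm (List A)} (h : IsMorphism μ ∨ IsAntimorphism μ)
    (w : List A) : (μ w).length = w.length := by
  apply le_antisymm
  · have := length_le_length_apply (μ⁻¹).injective (h.imp IsMorphism.inv IsAntimorphism.inv) (μ w)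
    simpa using this
  · exact length_le_length_apply μ.injective h w

theorem mem_orbit_self (G : Subgroup (Equiv.Perm (List A))) (w : List A) : w ∈ orbit G w :=
  ⟨1, G.one_mem, rfl⟩

theorem orbit_eq_of_mem {v w : List A} (h : v ∈ orbit G w) : orbit G v = orbit G w := by
  obtain ⟨μ, hμ, rfl⟩ := h
  ext x
  constructor
  · rintro ⟨ν, hν, rfl⟩
    exact ⟨ν * μ, G.mul_mem hν hμ, rfl⟩
  · rintro ⟨ν, hν, rfl⟩
    exact ⟨ν * μ⁻¹, G.mul_mem hν (G.inv_mem hμ), by simp⟩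

theorem orbit_eq_iff {v w : List A} : orbit G v = orbit G w ↔ ∃ μ ∈ G, μ v = w := by
  constructor
  · intro h
    have : w ∈ orbit G v := h ▸ mem_orbit_self G w
    obtain ⟨μ, hμ, e⟩ := this
    exact ⟨μ, hμ, e.symm⟩
  · rintro ⟨μ, hμ, rfl⟩
    exact (orbit_eq_of_mem ⟨μ, hμ, rfl⟩).symm

/-- The pair of `G` and `u` is symmetric: `G` consists of morphisms and antimorphisms, it contains
an antimorphism, and the language of `u` is closed under `G`. -/
structure IsSymmetric (G : Subgroup (Equiv.Perm (List A))) (u : ℕ → A) : Prop where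
  morphism_or_antimorphism : ∀ μ ∈ G, IsMorphism μ ∨ IsAntimorphism μ
  exists_antimorphism : ∃ Θ ∈ G, IsAntimorphism Θ
  closed : IsClosedUnder G u

/-- The class of the factor of length `n` of `u` at the index `i`. -/
def cls (G : Subgroup (Equiv.Perm (List A))) (u : ℕ → A) (n i : ℕ) : Set (List A) :=
  orbit G (factor u i n)

theorem cls_eq_of_apply_eq {μ : Equiv.Perm (List A)} (hμ : μ ∈ G) {n i j : ℕ}
    (h : μ (factor u i n) = factor u j n) : cls G u n i = cls G u n j :=
  orbit_eq_iff.2 ⟨μ, hμ, h⟩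

theorem cls_eq_of_factor_eq {n i j : ℕ} (h : factor u i n = factor u j n) :
    cls G u n i = cls G u n j := congrArg (orbit G) h

namespace IsSymmetric

variable (hS : IsSymmetric G u)
include hS

theorem length_apply {μ : Equiv.Perm (List A)} (hμ : μ ∈ G) (w : List A) :
    (μ w).length = w.length :=
  GRich.length_apply (hS.morphism_or_antimorphism μ hμ) w

theorem exists_apply_factor {μ : Equiv.Perm (List A)} (hμ : μ ∈ G) (i n : ℕ) :
    ∃ j, μ (factor u i n) = factor u j n := by
  obtain ⟨j, hj⟩ := exists_eq_factor (hS.closed _ (factor_mem_language u i n) μ hμ)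
  rw [hS.length_apply hμ, length_factor] at hj
  exact ⟨j, hj⟩

theorem apply_factor_of_isMorphism {μ : Equiv.Perm (List A)} (hμ : μ ∈ G) (hm : IsMorphism μ)
    {i j m : ℕ} (h : μ (factor u i m) = factor u j m) (a b : ℕ) (hab : a + b ≤ m) :
    μ (factor u (i + a) b) = factor u (j + a) b := by
  obtain ⟨c, rfl⟩ := Nat.exists_eq_add_of_le hab
  rw [factor_add, factor_add, hm, hm, factor_add, factor_add] at h
  have h1 := (List.append_inj h (by simp [hS.length_apply hμ])).1
  exact (List.append_inj h1 (by simp [hS.length_apply hμ])).2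

theorem apply_factor_of_isAntimorphism {μ : Equiv.Perm (List A)} (hμ : μ ∈ G)
    (hm : IsAntimorphism μ) {i j m : ℕ} (h : μ (factor u i m) = factor u j m) (a b c : ℕ)
    (hab : a + b + c = m) : μ (factor u (i + a) b) = factor u (j + c) b := by
  subst hab
  rw [factor_add, factor_add, hm, hm, show a + b + c = c + (b + a) by ring, factor_add,
    factor_add u (j + c)] at h
  have h1 := (List.append_inj h (by simp [hS.length_apply hμ])).2
  exact (List.append_inj h1 (by simp [hS.length_apply hμ])).1

/-- An antimorphism sends a prefix of length `i + m + K` to a factor in which the image of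
`u[i, i + m)` starts at an index at least `K`; hence every factor occurs arbitrarily late. -/
theorem recurrent (i m K : ℕ) : ∃ j, K ≤ j ∧ factor u j m = factor u i m := by
  obtain ⟨Θ, hΘ, ha⟩ := hS.exists_antimorphism
  obtain ⟨i', hi'⟩ := hS.exists_apply_factor (G.inv_mem hΘ) i m
  obtain ⟨l, hl⟩ := hS.exists_apply_factor hΘ 0 (i' + m + K)
  have := hS.apply_factor_of_isAntimorphism hΘ ha hl i' m K rfl
  refine ⟨l + K, by omega, ?_⟩
  rw [← this, zero_add, ← hi']
  simp

theorem isSpecial_apply {μ : Equiv.Perm (List A)} (hμ : μ ∈ G) {w : List A}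
    (hw : IsSpecial u w) : IsSpecial u (μ w) := by
  have key (a : A) : ∃ b, μ [a] = [b] := by
    rw [← List.length_eq_one_iff, hS.length_apply hμ]; rfl
  choose f hf using key
  have hinj : Function.Injective f := fun a b hab => by
    have : μ [a] = μ [b] := by rw [hf, hf, hab]
    simpa using μ.injective this
  obtain ⟨hL, h⟩ := hw
  refine ⟨hS.closed w hL μ hμ, ?_⟩
  rcases hS.morphism_or_antimorphism μ hμ with hm | hm
  · refine h.imp ?_ ?_
    · rintro ⟨a, ha, b, hb, hab⟩
      refine ⟨f a, ?_, f b, ?_, hinj.ne hab⟩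
      · have := hS.closed _ ha μ hμ
        rwa [← List.singleton_append, hm, hf] at this
      · have := hS.closed _ hb μ hμ
        rwa [← List.singleton_append, hm, hf] at this
    · rintro ⟨a, ha, b, hb, hab⟩
      refine ⟨f a, ?_, f b, ?_, hinj.ne hab⟩
      · have := hS.closed _ ha μ hμ
        rwa [hm, hf] at this
      · have := hS.closed _ hb μ hμ
        rwa [hm, hf] at this
  · refine h.symm.imp ?_ ?_
    · rintro ⟨a, ha, b, hb, hab⟩
      refine ⟨f a, ?_, f b, ?_, hinj.ne hab⟩
      · have := hS.closed _ ha μ hμ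
        rwa [hm, hf] at this
      · have := hS.closed _ hb μ hμ
        rwa [hm, hf] at this
    · rintro ⟨a, ha, b, hb, hab⟩
      refine ⟨f a, ?_, f b, ?_, hinj.ne hab⟩
      · have := hS.closed _ ha μ hμ
        rwa [← List.singleton_append, hm, hf] at this
      · have := hS.closed _ hb μ hμ
        rwa [← List.singleton_append, hm, hf] at this

theorem isSpecial_of_cls_eq {n i j : ℕ} (h : cls G u n i = cls G u n j)
    (hi : IsSpecial u (factor u i n)) : IsSpecial u (factor u j n) := by
  obtain ⟨μ, hμ, e⟩ := orbit_eq_iff.1 h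
  rw [← e]
  exact hS.isSpecial_apply hμ hi

theorem isSpecial_of_mem_vertices {n i : ℕ} (h : cls G u n i ∈ vertices G u n) :
    IsSpecial u (factor u i n) := by
  obtain ⟨w, -, hw, e⟩ := h
  obtain ⟨μ, hμ, e⟩ := orbit_eq_iff.1 e.symm
  rw [← e]
  exact hS.isSpecial_apply hμ hw

/-- A `G`-palindromic factor `u[i, i + d + n)` reflects the classes of its factors of length
`n`. -/
theorem cls_reflect {n i d a b : ℕ} (h : IsPalindrome G (factor u i (d + n)))
    (hab : a + b = d) : cls G u n (i + a) = cls G u n (i + b) := by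
  obtain ⟨Θ, hΘ, ha, e⟩ := h
  exact cls_eq_of_apply_eq hΘ
    (hS.apply_factor_of_isAntimorphism hΘ ha e a n b (by omega))

end IsSymmetric

theorem cls_mem_vertices {n i : ℕ} (h : IsSpecial u (factor u i n)) :
    cls G u n i ∈ vertices G u n := ⟨_, length_factor _ _ _, h, rfl⟩

theorem eq_cls_of_mem {n i : ℕ} {x : Set (List A)} (hx : x ∈ vertices G u n)
    (h : factor u i n ∈ x) : x = cls G u n i := by
  obtain ⟨w, -, -, rfl⟩ := hx
  exact (orbit_eq_of_mem h).symm

/-- Directed edges are the factors of `u` between two consecutive occurrences of special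
factors. -/
theorem isDirectedEdge_iff {n : ℕ} {e : List A} {x y : Set (List A)} :
    IsDirectedEdge G u n e x y ↔ ∃ k d, 0 < d ∧ e = factor u k (d + n) ∧ x = cls G u n k ∧
      y = cls G u n (k + d) ∧ IsSpecial u (factor u k n) ∧ IsSpecial u (factor u (k + d) n) ∧
      ∀ a, 0 < a → a < d → ¬ IsSpecial u (factor u (k + a) n) := by
  have hsub (k d a : ℕ) (ha : a ≤ d) :
      ((factor u k (d + n)).drop a).take n = factor u (k + a) n := by
    rw [show d + n = a + n + (d - a) by omega, take_drop_factor]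
  have hsuf (k d : ℕ) : (factor u k (d + n)).drop d = factor u (k + d) n := by
    rw [factor_add, List.drop_left' (by simp)]
  constructor
  · rintro ⟨he, hlen, hx, hy, hex, hey, hsp⟩
    obtain ⟨k, hk⟩ := exists_eq_factor he
    obtain ⟨d, hd⟩ : ∃ d, e.length = d + n := ⟨e.length - n, by omega⟩
    rw [hd] at hk hlen hey hsp
    subst hk
    simp only [Nat.add_sub_cancel] at hey hsp
    rw [← List.drop_zero (l := factor u k (d + n)), hsub k d 0 (Nat.zero_le _)] at hex
    rw [hsuf] at hey
    have hsp' (i : ℕ) (hi : i ≤ d) : IsSpecial u (factor u (k + i) n) ↔ i = 0 ∨ i = d := by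
      rw [← hsp i hi, hsub k d i hi]
    exact ⟨k, d, by omega, rfl, eq_cls_of_mem hx hex, eq_cls_of_mem hy hey,
      (hsp' 0 (Nat.zero_le _)).2 (Or.inl rfl), (hsp' d le_rfl).2 (Or.inr rfl),
      fun a h0 hd h => by have := (hsp' a hd.le).1 h; omega⟩
  · rintro ⟨k, d, hd, rfl, rfl, rfl, h1, h2, h3⟩
    refine ⟨factor_mem_language _ _ _, by simp; omega, cls_mem_vertices h1, cls_mem_vertices h2,
      ?_, ?_, ?_⟩
    · rw [← List.drop_zero (l := factor u k (d + n)), hsub k d 0 (Nat.zero_le _)]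
      exact mem_orbit_self _ _
    · simp only [length_factor, Nat.add_sub_cancel, hsuf]
      exact mem_orbit_self _ _
    · simp only [length_factor, Nat.add_sub_cancel]
      intro i hi
      rw [hsub k d i hi]
      constructor
      · intro h
        by_contra hne
        exact h3 i (by omega) (by omega) h
      · rintro (rfl | rfl)
        · exact h1
        · exact h2

/-! ### Complete return words of classes -/

/-- The indices `i < j` are consecutive occurrences of elements of the class of the factor of
length `n` at `i`; that is, `u[i, j + n)` is a complete `G`-return word. -/
def IsGReturn (G : Subgroup (Equiv.Perm (List A))) (u : ℕ → A) (n i j : ℕ) : Prop :=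
  i < j ∧ cls G u n j = cls G u n i ∧ ∀ t, i < t → t < j → cls G u n t ≠ cls G u n i

/-- All complete `G`-return words of factors of length `n` are `G`-palindromes. -/
def PalindromicReturns (G : Subgroup (Equiv.Perm (List A))) (u : ℕ → A) (n : ℕ) : Prop :=
  ∀ i d, IsGReturn G u n i (i + d) → IsPalindrome G (factor u i (d + n))

theorem exists_next {P : ℕ → Prop} {k l : ℕ} (hkl : k < l) (hl : P l) :
    ∃ m, k < m ∧ m ≤ l ∧ P m ∧ ∀ t, k < t → t < m → ¬ P t := by
  classical
  have h : ∃ m, k < m ∧ P m := ⟨l, hkl, hl⟩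
  refine ⟨Nat.find h, (Nat.find_spec h).1, Nat.find_min' h ⟨hkl, hl⟩, (Nat.find_spec h).2,
    fun t h1 h2 h3 => Nat.find_min h h2 ⟨h1, h3⟩⟩

theorem exists_prev {P : ℕ → Prop} {k l : ℕ} (hkl : k < l) (hk : P k) :
    ∃ m, k ≤ m ∧ m < l ∧ P m ∧ ∀ t, m < t → t < l → ¬ P t := by
  obtain ⟨d, h1, h2, h3, h4⟩ := exists_next (P := fun d => P (l - d)) (k := 0) (l := l - k)
    (by omega) (by simpa [Nat.sub_sub_self hkl.le] using hk)
  refine ⟨l - d, by omega, by omega, h3, fun t ht ht' h => ?_⟩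
  exact h4 (l - t) (by omega) (by omega) (by simpa [Nat.sub_sub_self ht'.le] using h)

theorem IsSymmetric.exists_cls_gt (hS : IsSymmetric G u) (n i k : ℕ) :
    ∃ l, k < l ∧ cls G u n l = cls G u n i := by
  obtain ⟨l, h1, h2⟩ := hS.recurrent i n (k + 1)
  exact ⟨l, h1, cls_eq_of_factor_eq h2⟩

/-! ### From palindromic complete return words to the tree-like structure -/

/-- The indices `k < l` are consecutive among the occurrences of elements of the classes `x` and
`y`, and one of the two classes occurs at `k` and the other one at `l`. -/
def IsSwitch (G : Subgroup (Equiv.Perm (List A))) (u : ℕ → A) (n : ℕ) (x y : Set (List A))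
    (k l : ℕ) : Prop :=
  k < l ∧ (cls G u n k = x ∧ cls G u n l = y ∨ cls G u n k = y ∧ cls G u n l = x) ∧
    ∀ t, k < t → t < l → cls G u n t ≠ x ∧ cls G u n t ≠ y

theorem IsSwitch.symm {n : ℕ} {x y : Set (List A)} {k l : ℕ} (h : IsSwitch G u n x y k l) :
    IsSwitch G u n y x k l :=
  ⟨h.1, h.2.1.symm, fun t h1 h2 => (h.2.2 t h1 h2).symm⟩

/-- The complete `G`-return word that starts at a switch from `x` to `y` is a `G`-palindrome, so it
ends with a switch from `y` to `x`, the image of the first one under an antimorphism. -/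
theorem IsSymmetric.exists_next_switch (hS : IsSymmetric G u) {n : ℕ}
    (hR : PalindromicReturns G u n) {x y : Set (List A)} (hxy : x ≠ y) {k d : ℕ}
    (h : IsSwitch G u n x y k (k + d)) :
    ∃ k₂, k < k₂ ∧ IsSwitch G u n x y k₂ (k₂ + d) ∧
      orbit G (factor u k (d + n)) = orbit G (factor u k₂ (d + n)) ∧
      ∀ l l', IsSwitch G u n x y l l' → k < l → k₂ ≤ l := by
  wlog hk : cls G u n k = x ∧ cls G u n (k + d) = y generalizing x y
  · obtain ⟨k₂, h1, h2, h3, h4⟩ := this hxy.symm h.symm (h.2.1.resolve_left hk)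
    exact ⟨k₂, h1, h2.symm, h3, fun l l' hl => h4 l l' hl.symm⟩
  obtain ⟨hd, -, hin⟩ := h
  obtain ⟨hkx, hky⟩ := hk
  obtain ⟨q, hq1, hq2⟩ := hS.exists_cls_gt n k k
  obtain ⟨m, hm1, -, hm2, hm3⟩ := exists_next (P := fun t => cls G u n t = cls G u n k) hq1 hq2
  have hm4 : k + d < m := by
    by_contra hc
    rcases (not_lt.1 hc).eq_or_lt with rfl | hc
    · exact hxy (by rw [← hkx, ← hm2, hky])
    · exact (hin m hm1 hc).1 (hm2.trans hkx)
  obtain ⟨D, rfl⟩ := Nat.exists_eq_add_of_lt hm1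
  rw [add_assoc] at hm1 hm2 hm3 hm4
  generalize D + 1 = D at *
  have hpal : IsPalindrome G (factor u k (D + n)) := hR k D ⟨hm1, hm2, hm3⟩
  have hrefl := fun a b hab => hS.cls_reflect (n := n) (a := a) (b := b) hpal hab
  have hy2 : cls G u n (k + (D - d)) = y := by
    rw [← hrefl d (D - d) (by omega), hky]
  have hge : d ≤ D - d := by
    by_contra hc
    exact (hin (k + (D - d)) (by omega) (by omega)).2 hy2
  refine ⟨k + (D - d), by omega, ⟨by omega, Or.inr ⟨hy2, ?_⟩, ?_⟩, ?_, ?_⟩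
  · rw [add_assoc, show D - d + d = D by omega, hm2, hkx]
  · intro t ht1 ht2
    obtain ⟨a, rfl⟩ := Nat.exists_eq_add_of_le (show k ≤ t by omega)
    rw [hrefl a (D - a) (by omega)]
    exact hin _ (by omega) (by omega)
  · obtain ⟨Θ, hΘ, ha, e⟩ := hpal
    have := hS.apply_factor_of_isAntimorphism hΘ ha e 0 (d + n) (D - d) (by omega)
    exact orbit_eq_iff.2 ⟨Θ, hΘ, this⟩
  · rintro l l' ⟨hl1, hl2, hl3⟩ hkl
    by_contra hc
    have hlx : cls G u n l ≠ x := fun h => hm3 l hkl (by omega) (h.trans hkx.symm)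
    have hl' : cls G u n l' = x := by
      rcases hl2 with h | h
      · exact absurd h.1 hlx
      · exact h.2
    have hl'm : k + D ≤ l' := by
      by_contra hc'
      exact hm3 l' (by omega) (by omega) (hl'.trans hkx.symm)
    exact (hl3 (k + (D - d)) (by omega) (by omega)).2 hy2

theorem IsSwitch.eq_right {n : ℕ} {x y : Set (List A)} {k l l' : ℕ}
    (h : IsSwitch G u n x y k l) (h' : IsSwitch G u n x y k l') : l = l' := by
  have key {l l' : ℕ} (h : IsSwitch G u n x y k l) (h' : IsSwitch G u n x y k l') : l ≤ l' := by
    by_contra hc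
    have := h.2.2 l' h'.1 (by omega)
    rcases h'.2.1 with h2 | h2
    · exact this.2 h2.2
    · exact this.1 h2.2
  exact le_antisymm (key h h') (key h' h)

/-- All factors of `u` that connect two consecutive occurrences of distinct classes `x` and `y`
belong to the same class. -/
theorem IsSymmetric.orbit_switch_eq (hS : IsSymmetric G u) {n : ℕ}
    (hR : PalindromicReturns G u n) {x y : Set (List A)} (hxy : x ≠ y) {k d l d' : ℕ}
    (h : IsSwitch G u n x y k (k + d)) (h' : IsSwitch G u n x y l (l + d')) :
    orbit G (factor u k (d + n)) = orbit G (factor u l (d' + n)) := by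
  -- By recurrence the second switch may be moved to the right of the first one.
  wlog hkl : k ≤ l generalizing l
  · obtain ⟨j, hj1, hj2⟩ := hS.recurrent l (d' + n) k
    have hc (a : ℕ) (ha : a ≤ d') : cls G u n (j + a) = cls G u n (l + a) :=
      cls_eq_of_factor_eq (factor_eq_of_factor_eq hj2 a n (by omega))
    rw [← hj2]
    refine this ⟨by have := h'.1; omega, ?_, ?_⟩ hj1
    · rw [hc d' le_rfl, ← add_zero j, hc 0 (Nat.zero_le _)]
      exact h'.2.1
    · intro t ht1 ht2
      obtain ⟨a, rfl⟩ := Nat.exists_eq_add_of_le ht1.le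
      rw [hc a (by omega)]
      exact h'.2.2 _ (by omega) (by omega)
  induction hm : l - k using Nat.strong_induction_on generalizing k with
  | _ m ih =>
    rcases hkl.eq_or_lt with rfl | hlt
    · have := h.eq_right h'
      rw [Nat.add_left_cancel this]
    · obtain ⟨k₂, h1, h2, h3, h4⟩ := hS.exists_next_switch hR hxy h
      have := h4 l _ h' hlt
      rw [h3]
      exact ih (l - k₂) (by omega) h2 this rfl

theorem IsSymmetric.exists_isSwitch (hS : IsSymmetric G u) {n : ℕ} {e : List A}
    {x y : Set (List A)} (h : IsDirectedEdge G u n e x y ∨ IsDirectedEdge G u n e y x) :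
    ∃ k d, IsSwitch G u n x y k (k + d) ∧ e = factor u k (d + n) ∧
      ∀ t, k < t → t < k + d → ¬ IsSpecial u (factor u t n) := by
  wlog h' : IsDirectedEdge G u n e x y generalizing x y
  · obtain ⟨k, d, h1, h2⟩ := this h.symm (h.resolve_left h')
    exact ⟨k, d, h1.symm, h2⟩
  obtain ⟨k, d, hd, rfl, rfl, rfl, h1, h2, h3⟩ := isDirectedEdge_iff.1 h'
  have h3' (t : ℕ) (ht1 : k < t) (ht2 : t < k + d) : ¬ IsSpecial u (factor u t n) := by
    obtain ⟨a, rfl⟩ := Nat.exists_eq_add_of_le ht1.le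
    exact h3 a (by omega) (by omega)
  exact ⟨k, d, ⟨by omega, Or.inl ⟨rfl, rfl⟩, fun t ht1 ht2 =>
    ⟨fun h => h3' t ht1 ht2 (hS.isSpecial_of_cls_eq h.symm h1),
      fun h => h3' t ht1 ht2 (hS.isSpecial_of_cls_eq h.symm h2)⟩⟩, rfl, h3'⟩

/-- If one switch between `x` and `y` is an edge, then there are no special factors strictly inside
any switch between `x` and `y`. -/
theorem IsSymmetric.not_isSpecial_of_isSwitch (hS : IsSymmetric G u) {n : ℕ}
    (hR : PalindromicReturns G u n) {x y : Set (List A)} (hxy : x ≠ y) {k d k' l' : ℕ}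
    (h : IsSwitch G u n x y k (k + d))
    (hk : ∀ t, k < t → t < k + d → ¬ IsSpecial u (factor u t n))
    (h' : IsSwitch G u n x y k' l') {t : ℕ} (ht1 : k' < t) (ht2 : t < l') :
    ¬ IsSpecial u (factor u t n) := by
  obtain ⟨d', rfl⟩ := Nat.exists_eq_add_of_le h'.1.le
  obtain ⟨μ, hμ, e⟩ := orbit_eq_iff.1 (hS.orbit_switch_eq hR hxy h h')
  have hdd : d = d' := by
    have := congrArg List.length e
    rw [hS.length_apply hμ] at this
    simpa using this
  subst hdd
  obtain ⟨a, rfl⟩ := Nat.exists_eq_add_of_le ht1.le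
  intro hsp
  rcases hS.morphism_or_antimorphism μ hμ with hm | hm
  · have := hS.apply_factor_of_isMorphism hμ hm e a n (by omega)
    exact hk (k + a) (by omega) (by omega)
      (hS.isSpecial_of_cls_eq (cls_eq_of_apply_eq hμ this).symm hsp)
  · have := hS.apply_factor_of_isAntimorphism hμ hm e (d - a) n a (by omega)
    exact hk (k + (d - a)) (by omega) (by omega)
      (hS.isSpecial_of_cls_eq (cls_eq_of_apply_eq hμ this).symm hsp)

/-- From the index `k` on, the class `x` occurs before the class `y` does. -/
def OnSide (G : Subgroup (Equiv.Perm (List A))) (u : ℕ → A) (n : ℕ) (x y : Set (List A))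
    (k : ℕ) : Prop :=
  ∃ m, k ≤ m ∧ cls G u n m = x ∧ ∀ t, k ≤ t → t ≤ m → cls G u n t ≠ y

theorem onSide_or {n : ℕ} {x y : Set (List A)} (hxy : x ≠ y) {k l : ℕ}
    (hkl : k < l) (hl : cls G u n l = x) : OnSide G u n x y k ∨ OnSide G u n y x k := by
  by_cases h0 : cls G u n k = x ∨ cls G u n k = y
  · rcases h0 with h0 | h0
    · refine Or.inl ⟨k, le_rfl, h0, fun t h1 h2 => ?_⟩
      rw [le_antisymm h2 h1, h0]
      exact hxy
    · refine Or.inr ⟨k, le_rfl, h0, fun t h1 h2 => ?_⟩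
      rw [le_antisymm h2 h1, h0]
      exact hxy.symm
  obtain ⟨m, h1, -, h3, h4⟩ :=
    exists_next (P := fun t => cls G u n t = x ∨ cls G u n t = y) hkl (Or.inl hl)
  have h5 (t : ℕ) (ht : k ≤ t) (htm : t < m) : ¬ (cls G u n t = x ∨ cls G u n t = y) := by
    rcases ht.eq_or_lt with rfl | ht
    · exact h0
    · exact h4 t ht htm
  rcases h3 with h3 | h3
  · refine Or.inl ⟨m, h1.le, h3, fun t ht htm h => ?_⟩
    rcases htm.eq_or_lt with rfl | htm
    · exact hxy (h3.symm.trans h)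
    · exact h5 t ht htm (Or.inr h)
  · refine Or.inr ⟨m, h1.le, h3, fun t ht htm h => ?_⟩
    rcases htm.eq_or_lt with rfl | htm
    · exact hxy (h.symm.trans h3)
    · exact h5 t ht htm (Or.inl h)

theorem not_onSide_and {n : ℕ} {x y : Set (List A)} {k : ℕ}
    (h : OnSide G u n x y k) (h' : OnSide G u n y x k) : False := by
  obtain ⟨m, h1, h2, h3⟩ := h
  obtain ⟨m', h1', h2', h3'⟩ := h'
  rcases le_total m m' with hm | hm
  · exact h3' m h1 hm h2
  · exact h3 m' h1' hm h2'

section Bridge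

/-- No special factor of length `n` occurs strictly inside a switch between `x` and `y`: the word
`u` passes between the two classes only along edges that join them. -/
def EdgeOnly (G : Subgroup (Equiv.Perm (List A))) (u : ℕ → A) (n : ℕ) (x y : Set (List A)) :
    Prop :=
  ∀ k l t, IsSwitch G u n x y k l → k < t → t < l → ¬ IsSpecial u (factor u t n)

theorem EdgeOnly.symm {n : ℕ} {x y : Set (List A)} (h : EdgeOnly G u n x y) :
    EdgeOnly G u n y x := fun k l t hkl => h k l t hkl.symm

variable (hS : IsSymmetric G u)
include hS

/-- A special factor that is preceded by `x`, with no `y` in between, is followed by `x` before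
`y`: otherwise it would lie strictly inside a switch. -/
theorem IsSymmetric.onSide_of_prev {n : ℕ} {x y : Set (List A)} (hxy : x ≠ y)
    (hE : EdgeOnly G u n x y) {p k : ℕ} (hpk : p < k) (hp : cls G u n p = x)
    (hy : ∀ t, p < t → t ≤ k → cls G u n t ≠ y) (hk : IsSpecial u (factor u k n)) :
    OnSide G u n x y k := by
  obtain ⟨l, hl1, hl2⟩ := hS.exists_cls_gt n p k
  refine (onSide_or hxy hl1 (hl2.trans hp)).resolve_right ?_
  rintro ⟨m, h1, h2, h3⟩
  have hkm : k < m := h1.lt_of_ne (by rintro rfl; exact hy _ hpk le_rfl h2)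
  obtain ⟨r, hr1, hr2, hr3, hr4⟩ := exists_next (P := fun t => cls G u n t = y) hkm h2
  obtain ⟨q, hq1, hq2, hq3, hq4⟩ :=
    exists_prev (P := fun t => cls G u n t = x) (hpk.trans hr1) hp
  have hqk : q < k := by
    by_contra hc
    exact h3 q (by omega) (by omega) hq3
  refine hE q r k ⟨hq2, Or.inl ⟨hq3, hr3⟩, fun t ht1 ht2 => ⟨hq4 t ht1 ht2, ?_⟩⟩ hqk hr1 hk
  rcases le_or_gt t k with htk | htk
  · exact hy t (by omega) htk
  · exact hr4 t htk ht2

theorem IsSymmetric.onSide_of_isGReturn {n : ℕ} (hR : PalindromicReturns G u n)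
    {x y : Set (List A)} (hxy : x ≠ y) (hE : EdgeOnly G u n x y) {k d : ℕ}
    (hret : IsGReturn G u n k (k + d)) (hk : IsSpecial u (factor u k n))
    (hky : cls G u n k ≠ y) (h : OnSide G u n x y k) : OnSide G u n x y (k + d) := by
  obtain ⟨m, h1, h2, h3⟩ := h
  rcases le_or_gt (k + d) m with hm | hm
  · exact ⟨m, hm, h2, fun t ht => h3 t (by omega)⟩
  obtain ⟨a, rfl⟩ := Nat.exists_eq_add_of_le h1
  have hrefl := fun a b hab => hS.cls_reflect (n := n) (a := a) (b := b) (hR k d hret) hab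
  have hsp := hS.isSpecial_of_cls_eq hret.2.1.symm hk
  rcases Nat.eq_zero_or_pos a with rfl | ha
  · refine ⟨k + d, le_rfl, hret.2.1.trans h2, fun t ht1 ht2 => ?_⟩
    rw [le_antisymm ht2 ht1, hret.2.1]
    exact hky
  · refine hS.onSide_of_prev hxy hE (p := k + (d - a)) (by omega)
      (by rw [← hrefl a _ (by omega), h2]) (fun t ht1 ht2 => ?_) hsp
    obtain ⟨b, rfl⟩ := Nat.exists_eq_add_of_le (show k ≤ t by omega)
    rw [hrefl b (d - b) (by omega)]
    exact h3 _ (by omega) (by omega)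

/-- All occurrences of a class of special factors lie on the same side. -/
theorem IsSymmetric.onSide_of_cls_eq {n : ℕ} (hR : PalindromicReturns G u n)
    {x y : Set (List A)} (hxy : x ≠ y) (hE : EdgeOnly G u n x y) {k l : ℕ}
    (hkl : cls G u n k = cls G u n l) (hk : IsSpecial u (factor u k n))
    (h : OnSide G u n x y k) : OnSide G u n x y l := by
  have hlx (k : ℕ) : ∃ l, k < l ∧ cls G u n l = x := by
    obtain ⟨m, -, h2, -⟩ := h
    obtain ⟨l, h3, h4⟩ := hS.exists_cls_gt n m k
    exact ⟨l, h3, h4.trans h2⟩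
  have hky : cls G u n k ≠ y := by
    obtain ⟨m, h1, -, h3⟩ := h
    exact h3 k le_rfl h1
  by_cases hkx : cls G u n k = x
  · refine ⟨l, le_rfl, hkl.symm.trans hkx, fun t ht1 ht2 => ?_⟩
    rw [le_antisymm ht2 ht1, ← hkl]
    exact hky
  have key (m : ℕ) : ∀ k l, l - k ≤ m → k ≤ l → cls G u n k = cls G u n l →
      IsSpecial u (factor u k n) → cls G u n k ≠ x → cls G u n k ≠ y →
      (OnSide G u n x y k ↔ OnSide G u n x y l) := by
    induction m with
    | zero =>
      intro k l h1 h2 _ _ _ _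
      rw [show k = l by omega]
    | succ m ih =>
      intro k l h1 h2 h3 h4 h5 h6
      rcases h2.eq_or_lt with rfl | h2
      · rfl
      obtain ⟨r, hr1, hr2, hr3, hr4⟩ :=
        exists_next (P := fun t => cls G u n t = cls G u n k) h2 h3.symm
      obtain ⟨d, rfl⟩ := Nat.exists_eq_add_of_le hr1.le
      have hret : IsGReturn G u n k (k + d) := ⟨hr1, hr3, hr4⟩
      rw [← ih (k + d) l (by omega) hr2 (hr3.trans h3) (hS.isSpecial_of_cls_eq hr3.symm h4)
        (hr3 ▸ h5) (hr3 ▸ h6)]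
      refine ⟨hS.onSide_of_isGReturn hR hxy hE hret h4 h6, fun h => ?_⟩
      obtain ⟨l, hl1, hl2⟩ := hlx k
      refine (onSide_or hxy hl1 hl2).resolve_right fun h' => ?_
      exact not_onSide_and h (hS.onSide_of_isGReturn hR hxy.symm hE.symm hret h4 h5 h')
  rcases le_total k l with hle | hle
  · exact (key _ k l le_rfl hle hkl hk hkx hky).1 h
  · exact (key _ l k le_rfl hle hkl.symm (hS.isSpecial_of_cls_eq hkl hk) (hkl ▸ hkx)
      (hkl ▸ hky)).2 h

/-- Edges other than the one joining `x` and `y` do not lead away from the side of `x`. -/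
theorem IsSymmetric.onSide_of_isDirectedEdge {n : ℕ} {x y : Set (List A)} (hxy : x ≠ y)
    (hE : EdgeOnly G u n x y) (hx : x ∈ vertices G u n) (hy : y ∈ vertices G u n)
    {k d : ℕ} (hd : 0 < d)
    (hkd : IsSpecial u (factor u (k + d) n))
    (hin : ∀ a, 0 < a → a < d → ¬ IsSpecial u (factor u (k + a) n))
    (hne : ¬ (cls G u n k = x ∧ cls G u n (k + d) = y))
    (h : OnSide G u n x y k) : OnSide G u n x y (k + d) := by
  obtain ⟨m, h1, h2, h3⟩ := h
  rcases le_or_gt (k + d) m with hm | hm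
  · exact ⟨m, hm, h2, fun t ht => h3 t (by omega)⟩
  have hmsp : IsSpecial u (factor u m n) := hS.isSpecial_of_mem_vertices (h2 ▸ hx)
  obtain ⟨a, rfl⟩ := Nat.exists_eq_add_of_le h1
  obtain rfl : a = 0 := by
    by_contra hc
    exact hin a (by omega) (by omega) hmsp
  by_cases hX : cls G u n (k + d) = x
  · refine ⟨k + d, le_rfl, hX, fun t ht1 ht2 => ?_⟩
    rw [le_antisymm ht2 ht1, hX]
    exact hxy
  have hky : cls G u n (k + d) ≠ y := fun h => hne ⟨h2, h⟩
  refine hS.onSide_of_prev hxy hE (p := k) (by omega) h2 (fun t ht1 ht2 hty => ?_) hkd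
  rcases ht2.eq_or_lt with rfl | ht2
  · exact hky hty
  obtain ⟨a, rfl⟩ := Nat.exists_eq_add_of_le ht1.le
  exact hin a (by omega) (by omega) (hS.isSpecial_of_mem_vertices (hty ▸ hy))

end Bridge

theorem underlyingGraph_adj {n k d : ℕ} (hd : 0 < d) (hk : IsSpecial u (factor u k n))
    (hkd : IsSpecial u (factor u (k + d) n))
    (hin : ∀ a, 0 < a → a < d → ¬ IsSpecial u (factor u (k + a) n))
    (hne : cls G u n k ≠ cls G u n (k + d)) :
    (underlyingGraph G u n).Adj ⟨cls G u n k, cls_mem_vertices hk⟩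
      ⟨cls G u n (k + d), cls_mem_vertices hkd⟩ :=
  ⟨fun h => hne (congrArg Subtype.val h), _, _, rfl,
    Or.inl (isDirectedEdge_iff.2 ⟨k, d, hd, rfl, rfl, rfl, hk, hkd, hin⟩)⟩

/-- The classes of the special factors that occur in a stretch of `u` form a walk in every graph
that contains the edges used along that stretch. -/
theorem reachable_of_isSpecial {n : ℕ} {H : SimpleGraph (vertices G u n)} {l : ℕ}
    (hl : IsSpecial u (factor u l n)) {k : ℕ} (hkl : k ≤ l) (hk : IsSpecial u (factor u k n))
    (hadj : ∀ r d (hr : IsSpecial u (factor u r n)) (hrd : IsSpecial u (factor u (r + d) n)),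
      k ≤ r → r + d ≤ l → 0 < d → (∀ a, 0 < a → a < d → ¬ IsSpecial u (factor u (r + a) n)) →
      cls G u n r ≠ cls G u n (r + d) →
      H.Adj ⟨cls G u n r, cls_mem_vertices hr⟩ ⟨cls G u n (r + d), cls_mem_vertices hrd⟩) :
    H.Reachable ⟨cls G u n k, cls_mem_vertices hk⟩ ⟨cls G u n l, cls_mem_vertices hl⟩ := by
  induction hm : l - k using Nat.strong_induction_on generalizing k with
  | _ m ih =>
    rcases hkl.eq_or_lt with rfl | hlt
    · rfl
    obtain ⟨r, hr1, hr2, hr3, hr4⟩ :=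
      exists_next (P := fun t => IsSpecial u (factor u t n)) hlt hl
    obtain ⟨d, rfl⟩ := Nat.exists_eq_add_of_le hr1.le
    have h1 := ih (l - (k + d)) (by omega) hr2 hr3
      (fun r d hr hrd h => hadj r d hr hrd (by omega)) rfl
    refine SimpleGraph.Reachable.trans ?_ h1
    by_cases hc : cls G u n k = cls G u n (k + d)
    · simp only [hc]
      rfl
    · exact (hadj k d hk hr3 le_rfl hr2 (by omega)
        (fun a ha had => hr4 _ (by omega) (by omega)) hc).reachable

theorem exists_cls_eq_of_mem_vertices {n : ℕ} {x : Set (List A)} (hx : x ∈ vertices G u n) :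
    ∃ k, x = cls G u n k ∧ IsSpecial u (factor u k n) := by
  obtain ⟨w, rfl, hw, rfl⟩ := hx
  obtain ⟨k, hk⟩ := exists_eq_factor hw.1
  exact ⟨k, by rw [cls, ← hk], hk ▸ hw⟩

theorem IsSymmetric.preconnected_underlyingGraph (hS : IsSymmetric G u) (n : ℕ) :
    (underlyingGraph G u n).Preconnected := by
  rintro ⟨x, hx⟩ ⟨y, hy⟩
  obtain ⟨k, rfl, hk⟩ := exists_cls_eq_of_mem_vertices hx
  obtain ⟨l, rfl, hl⟩ := exists_cls_eq_of_mem_vertices hy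
  obtain ⟨l', h1, h2⟩ := hS.exists_cls_gt n l k
  have := reachable_of_isSpecial (G := G) (H := underlyingGraph G u n)
    (hS.isSpecial_of_cls_eq h2.symm hl) h1.le hk
    (fun r d hr hrd _ _ hd hin hne => underlyingGraph_adj hd hr hrd hin hne)
  simpa only [h2] using this

theorem IsSymmetric.edgeOnly_of_isDirectedEdge (hS : IsSymmetric G u) {n : ℕ}
    (hR : PalindromicReturns G u n) {e : List A} {x y : Set (List A)} (hxy : x ≠ y)
    (h : IsDirectedEdge G u n e x y ∨ IsDirectedEdge G u n e y x) : EdgeOnly G u n x y := by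
  obtain ⟨k, d, hsw, -, hin⟩ := hS.exists_isSwitch h
  intro k' l' t h' h1 h2
  exact hS.not_isSpecial_of_isSwitch hR hxy hsw hin h' h1 h2

theorem IsSymmetric.isAcyclic_underlyingGraph (hS : IsSymmetric G u) {n : ℕ}
    (hR : PalindromicReturns G u n) : (underlyingGraph G u n).IsAcyclic := by
  rw [SimpleGraph.isAcyclic_iff_forall_adj_isBridge]
  rintro ⟨x, hx⟩ ⟨y, hy⟩ ⟨hne, c, e, -, he⟩
  have hxy : x ≠ y := fun h => hne (Subtype.ext h)
  have hE := hS.edgeOnly_of_isDirectedEdge hR hxy he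
  rw [SimpleGraph.isBridge_iff]
  intro hreach
  -- Having an occurrence on the side of `x` is preserved along all edges but the one deleted.
  have hinv (v w : vertices G u n)
      (hvw : ((underlyingGraph G u n).deleteEdges {s(⟨x, hx⟩, ⟨y, hy⟩)}).Adj v w)
      (hv : ∃ k, cls G u n k = v ∧ OnSide G u n x y k) :
      ∃ k, cls G u n k = w ∧ OnSide G u n x y k := by
    rw [SimpleGraph.deleteEdges_adj] at hvw
    obtain ⟨⟨-, c, e, -, he⟩, hdel⟩ := hvw
    obtain ⟨k, hkv, hk⟩ := hv
    have hv' : ¬ ((v : Set (List A)) = x ∧ (w : Set (List A)) = y) := by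
      rintro ⟨h1, h2⟩
      apply hdel
      rw [show v = ⟨x, hx⟩ from Subtype.ext h1, show w = ⟨y, hy⟩ from Subtype.ext h2]
      exact Set.mem_singleton _
    have hw' : ¬ ((v : Set (List A)) = y ∧ (w : Set (List A)) = x) := by
      rintro ⟨h1, h2⟩
      apply hdel
      rw [show v = ⟨y, hy⟩ from Subtype.ext h1, show w = ⟨x, hx⟩ from Subtype.ext h2, Sym2.eq_swap]
      exact Set.mem_singleton _
    have hksp : IsSpecial u (factor u k n) := hS.isSpecial_of_mem_vertices (hkv ▸ v.2)
    rcases he with he | he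
    · obtain ⟨l, d, hd, -, h1, h2, h3, h4, h5⟩ := isDirectedEdge_iff.1 he
      refine ⟨l + d, h2.symm, hS.onSide_of_isDirectedEdge hxy hE hx hy hd h4 h5 ?_ ?_⟩
      · rwa [← h1, ← h2]
      · exact hS.onSide_of_cls_eq hR hxy hE (hkv.trans h1) hksp hk
    · obtain ⟨l, d, hd, -, h1, h2, h3, h4, h5⟩ := isDirectedEdge_iff.1 he
      refine ⟨l, h1.symm, ?_⟩
      obtain ⟨r, hr1, hr2⟩ : ∃ r, l < r ∧ cls G u n r = x := by
        obtain ⟨r, rfl, -⟩ := exists_cls_eq_of_mem_vertices hx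
        exact hS.exists_cls_gt n r l
      refine (onSide_or hxy hr1 hr2).resolve_right fun h => ?_
      have h' := hS.onSide_of_isDirectedEdge hxy.symm hE.symm hy hx hd h4 h5
        (by rw [← h1, ← h2]; exact fun h => hv' ⟨h.2, h.1⟩) h
      exact not_onSide_and (hS.onSide_of_cls_eq hR hxy hE (hkv.trans h2) hksp hk) h'
  have hwalk (v w : vertices G u n)
      (p : ((underlyingGraph G u n).deleteEdges {s(⟨x, hx⟩, ⟨y, hy⟩)}).Walk v w) :
      (∃ k, cls G u n k = v ∧ OnSide G u n x y k) →
        ∃ k, cls G u n k = w ∧ OnSide G u n x y k := by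
    induction p with
    | nil => exact id
    | cons h _ ih => exact fun hv => ih (hinv _ _ h hv)
  obtain ⟨p⟩ := hreach
  obtain ⟨k, hk, -⟩ := exists_cls_eq_of_mem_vertices hx
  obtain ⟨l, hl, m, h1, -, h3⟩ := hwalk _ _ p ⟨k, hk.symm, k, le_rfl, hk.symm, fun t h1 h2 => by
    rw [le_antisymm h2 h1, ← hk]
    exact hxy⟩
  exact h3 l le_rfl h1 hl

theorem IsSymmetric.isTreeWithoutLoops (hS : IsSymmetric G u) {n : ℕ}
    (hR : PalindromicReturns G u n) : IsTreeWithoutLoops G u n := by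
  refine ⟨?_, hS.preconnected_underlyingGraph n, hS.isAcyclic_underlyingGraph hR⟩
  rintro x y hxy _ _ ⟨e, rfl, he⟩ ⟨f, rfl, hf⟩
  obtain ⟨k, d, h1, rfl, -⟩ := hS.exists_isSwitch he
  obtain ⟨k', d', h1', rfl, -⟩ := hS.exists_isSwitch hf
  exact hS.orbit_switch_eq hR hxy h1 h1'

/-- A loop is a complete `G`-return word, because all elements of the class of a special factor are
special. -/
theorem IsSymmetric.isPalindrome_of_loop (hS : IsSymmetric G u) {n : ℕ}
    (hR : PalindromicReturns G u n) {e : List A} {x : Set (List A)}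
    (he : IsDirectedEdge G u n e x x) : IsPalindrome G e := by
  obtain ⟨k, d, hd, rfl, rfl, h2, h3, h4, h5⟩ := isDirectedEdge_iff.1 he
  refine hR k d ⟨by omega, h2.symm, fun t ht1 ht2 h => ?_⟩
  obtain ⟨a, rfl⟩ := Nat.exists_eq_add_of_le ht1.le
  exact h5 a (by omega) (by omega) (hS.isSpecial_of_cls_eq h.symm h3)

theorem IsSymmetric.propertyTls_of_palindromicReturns (hS : IsSymmetric G u) {N : ℕ}
    (hR : ∀ n, N ≤ n → PalindromicReturns G u n) : PropertyTls G u N := fun n hn =>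
  ⟨hS.closed, fun _ _ he => hS.isPalindrome_of_loop (hR n hn) he,
    hS.isTreeWithoutLoops (hR n hn)⟩

/-! ### From the tree-like structure to palindromic complete return words -/

section

variable (hS : IsSymmetric G u)
include hS

/-- A complete `G`-return word of a special factor is a closed walk in a tree with loops, without
visits to the starting point in between: either it is a loop, or its first and its last edge
coincide. In both cases an antimorphism of `G` exchanges a prefix and a suffix longer than `n`. -/
theorem IsSymmetric.exists_antimorphism_of_isSpecial {n : ℕ}
    (hloop : ∀ x e, IsDirectedEdge G u n e x x → IsPalindrome G e)
    (htree : IsTreeWithoutLoops G u n) {i d : ℕ} (hret : IsGReturn G u n i (i + d))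
    (hi : IsSpecial u (factor u i n)) :
    ∃ l, 0 < l ∧ l ≤ d ∧ ∃ Θ ∈ G, IsAntimorphism Θ ∧
      Θ (factor u i (l + n)) = factor u (i + (d - l)) (l + n) := by
  obtain ⟨hid, hcls, hin⟩ := hret
  have hisp := hS.isSpecial_of_cls_eq hcls.symm hi
  obtain ⟨r, hr1, hr2, hr3, hr4⟩ :=
    exists_next (P := fun t => IsSpecial u (factor u t n)) hid hisp
  obtain ⟨a, rfl⟩ := Nat.exists_eq_add_of_le hr1.le
  have he : IsDirectedEdge G u n (factor u i (a + n)) (cls G u n i) (cls G u n (i + a)) :=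
    isDirectedEdge_iff.2 ⟨i, a, by omega, rfl, rfl, rfl, hi, hr3,
      fun b h1 h2 => hr4 _ (by omega) (by omega)⟩
  rcases (show a ≤ d by omega).eq_or_lt with rfl | had
  · obtain ⟨Θ, hΘ, hanti, e⟩ := hloop _ _ (by rwa [hcls] at he)
    exact ⟨a, by omega, le_rfl, Θ, hΘ, hanti, by simpa using e⟩
  obtain ⟨q, hq1, hq2, hq3, hq4⟩ :=
    exists_prev (P := fun t => IsSpecial u (factor u t n)) (show i + a < i + d by omega) hr3
  obtain ⟨b, rfl⟩ := Nat.exists_eq_add_of_le (show i ≤ q by omega)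
  obtain ⟨c, rfl⟩ := Nat.exists_eq_add_of_le (show b ≤ d by omega)
  rw [← add_assoc] at hcls hisp hin hq2 hq4
  have hf : IsDirectedEdge G u n (factor u (i + b) (c + n)) (cls G u n (i + b))
      (cls G u n (i + b + c)) :=
    isDirectedEdge_iff.2 ⟨i + b, c, by omega, rfl, rfl, rfl, hq3, hisp,
      fun b h1 h2 => hq4 _ (by omega) (by omega)⟩
  rw [hcls] at hf
  have hy : cls G u n (i + a) ≠ cls G u n i := hin _ (by omega) (by omega)
  have hz : cls G u n (i + b) ≠ cls G u n i := hin _ (by omega) (by omega)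
  have hyz : cls G u n (i + a) = cls G u n (i + b) := by
    by_contra hyz
    have hadj := underlyingGraph_adj (G := G) (show 0 < a by omega) hi hr3
      (fun b h1 h2 => hr4 _ (by omega) (by omega)) hy.symm
    have hbr := (SimpleGraph.isAcyclic_iff_forall_adj_isBridge.1 htree.2.2) hadj
    rw [SimpleGraph.isBridge_iff] at hbr
    refine hbr (SimpleGraph.Reachable.symm ?_)
    refine (reachable_of_isSpecial (l := i + b) hq3 hq1 hr3 ?_).trans (SimpleGraph.Adj.reachable ?_)
    · intro r e hr hre h1 h2 h3 h4 h5
      rw [SimpleGraph.deleteEdges_adj]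
      refine ⟨underlyingGraph_adj h3 hr hre h4 h5, ?_⟩
      have h6 := hin r (by omega) (by omega)
      have h7 := hin (r + e) (by omega) (by omega)
      simp [h6, h7]
    · rw [SimpleGraph.deleteEdges_adj]
      refine ⟨⟨fun h => hz (congrArg Subtype.val h), _, _, rfl, Or.inl hf⟩, ?_⟩
      simp [hz, Ne.symm hyz]
  rw [← hyz] at hf
  obtain ⟨μ, hμ, e⟩ := orbit_eq_iff.1 (htree.1 _ _ hy.symm _ _ ⟨_, rfl, Or.inl he⟩
    ⟨_, rfl, Or.inr hf⟩)
  have hac : a = c := by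
    have := congrArg List.length e
    rw [hS.length_apply hμ] at this
    simpa using this
  subst hac
  refine ⟨a, by omega, by omega, μ, hμ, ?_, by simpa using e⟩
  refine (hS.morphism_or_antimorphism μ hμ).resolve_left fun hm => hz ?_
  exact (cls_eq_of_apply_eq hμ (hS.apply_factor_of_isMorphism hμ hm e 0 n (by omega))).symm

/-- If the prefix and the suffix of length `k + n` of a complete `G`-return word belong to the same
class, then the word is also a complete `G`-return word of this longer prefix. -/
theorem IsSymmetric.isGReturn_extend {n i d k : ℕ} (hret : IsGReturn G u n i (i + d))
    (hk : k < d) (h : cls G u (k + n) (i + (d - k)) = cls G u (k + n) i) :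
    IsGReturn G u (k + n) i (i + (d - k)) := by
  refine ⟨by omega, h, fun t ht1 ht2 ht => ?_⟩
  obtain ⟨μ, hμ, e⟩ := orbit_eq_iff.1 ht.symm
  rcases hS.morphism_or_antimorphism μ hμ with hm | hm
  · exact hret.2.2 t ht1 (by omega)
      (cls_eq_of_apply_eq hμ (hS.apply_factor_of_isMorphism hμ hm e 0 n (by omega))).symm
  · exact hret.2.2 (t + k) (by omega) (by omega) (cls_eq_of_apply_eq hμ
      (hS.apply_factor_of_isAntimorphism hμ hm e 0 n k (by omega))).symm

/-- If an antimorphism of `G` exchanges the prefix and the suffix of length `n` of a complete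
`G`-return word, then the word is a `G`-palindrome: the longest prefix that is exchanged with a
suffix in this way is special unless it is the whole word. -/
theorem IsSymmetric.isPalindrome_of_exists_antimorphism {N : ℕ} (hT : PropertyTls G u N) {n : ℕ}
    (hn : N ≤ n) {i d : ℕ} (hret : IsGReturn G u n i (i + d))
    (h : ∃ Θ ∈ G, IsAntimorphism Θ ∧ Θ (factor u i n) = factor u (i + d) n) :
    IsPalindrome G (factor u i (d + n)) := by
  have step (k : ℕ) (hk : k < d) (h : ∃ Θ ∈ G, IsAntimorphism Θ ∧
      Θ (factor u i (k + n)) = factor u (i + (d - k)) (k + n)) :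
      ∃ l, k < l ∧ l ≤ d ∧ ∃ Θ ∈ G, IsAntimorphism Θ ∧
        Θ (factor u i (l + n)) = factor u (i + (d - l)) (l + n) := by
    obtain ⟨Θ, hΘ, ha, e⟩ := h
    by_cases hsp : IsSpecial u (factor u (i + (d - k)) (k + n))
    · have hc := cls_eq_of_apply_eq hΘ e
      obtain ⟨l, h1, h2, Θ', h3, h4, h5⟩ := hS.exists_antimorphism_of_isSpecial
        (hT (k + n) (by omega)).2.1 (hT (k + n) (by omega)).2.2
        (hS.isGReturn_extend hret hk hc.symm) (hS.isSpecial_of_cls_eq hc.symm hsp)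
      refine ⟨l + k, by omega, by omega, Θ', h3, h4, ?_⟩
      rw [add_assoc, h5]
      congr 2
      omega
    · refine ⟨k + 1, by omega, by omega, Θ, hΘ, ha, ?_⟩
      obtain ⟨j, hj⟩ := hS.exists_apply_factor hΘ i (k + n + 1)
      have h1 := hS.apply_factor_of_isAntimorphism hΘ ha hj 0 (k + n) 1 (by omega)
      rw [add_zero, e] at h1
      rw [show k + 1 + n = k + n + 1 by omega, hj]
      rw [show i + (d - k) = i + (d - (k + 1)) + 1 by omega] at h1 hsp
      exact (factor_succ_eq_of_not_isSpecial' hsp h1).symm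
  have key (m : ℕ) : ∀ k, d - k ≤ m → k ≤ d → (∃ Θ ∈ G, IsAntimorphism Θ ∧
      Θ (factor u i (k + n)) = factor u (i + (d - k)) (k + n)) →
      IsPalindrome G (factor u i (d + n)) := by
    induction m with
    | zero =>
      rintro k h1 h2 ⟨Θ, hΘ, ha, e⟩
      obtain rfl : k = d := by omega
      exact ⟨Θ, hΘ, ha, by simpa using e⟩
    | succ m ih =>
      intro k h1 h2 h
      rcases h2.eq_or_lt with rfl | h2
      · exact ih k (by omega) le_rfl h
      · obtain ⟨l, h3, h4, h5⟩ := step k h2 h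
        exact ih l (by omega) h4 h5
  exact key d 0 (by omega) (by omega) (by simpa using h)

end

/-- A complete `G`-return word `u[i, i + d + n)` such that no antimorphism of `G` sends its prefix
of length `n` to its suffix of length `n`. -/
def IsDirectReturn (G : Subgroup (Equiv.Perm (List A))) (u : ℕ → A) (n i d : ℕ) : Prop :=
  IsGReturn G u n i (i + d) ∧
    ∀ Θ ∈ G, IsAntimorphism Θ → Θ (factor u i n) ≠ factor u (i + d) n

section

variable (hS : IsSymmetric G u)
include hS

theorem IsSymmetric.exists_morphism_of_isDirectReturn {n i d : ℕ}
    (h : IsDirectReturn G u n i d) :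
    ∃ μ ∈ G, IsMorphism μ ∧ μ (factor u i n) = factor u (i + d) n := by
  obtain ⟨μ, hμ, e⟩ := orbit_eq_iff.1 h.1.2.1.symm
  exact ⟨μ, hμ, (hS.morphism_or_antimorphism μ hμ).resolve_right fun ha => h.2 μ hμ ha e, e⟩

theorem IsSymmetric.isDirectReturn_map {n i j d : ℕ} (h : IsDirectReturn G u n i d)
    {ν : Equiv.Perm (List A)} (hν : ν ∈ G) (hm : IsMorphism ν)
    (e : ν (factor u i (d + n)) = factor u j (d + n)) : IsDirectReturn G u n j d := by
  obtain ⟨⟨h1, h2, h3⟩, h4⟩ := h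
  have hsub := fun a ha => hS.apply_factor_of_isMorphism hν hm e a n ha
  have hcls (a : ℕ) (ha : a ≤ d) : cls G u n (i + a) = cls G u n (j + a) :=
    cls_eq_of_apply_eq hν (hsub a (by omega))
  have h0 : cls G u n i = cls G u n j := hcls 0 (Nat.zero_le _)
  refine ⟨⟨by omega, by rw [← hcls d le_rfl, h2, h0], fun t ht1 ht2 => ?_⟩, fun Θ hΘ ha h => ?_⟩
  · obtain ⟨a, rfl⟩ := Nat.exists_eq_add_of_le ht1.le
    rw [← hcls a (by omega), ← h0]
    exact h3 _ (by omega) (by omega)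
  · refine h4 (ν⁻¹ * (Θ * ν)) (G.mul_mem (G.inv_mem hν) (G.mul_mem hΘ hν))
      (hm.inv.mul_antimorphism fun v w => ?_) ?_
    · simp [hm v w, ha (ν v) (ν w)]
    · have e0 : ν (factor u i n) = factor u j n := hsub 0 (by omega)
      simp [e0, h, ← hsub d (by omega)]

variable {N : ℕ} (hT : PropertyTls G u N)
include hT

theorem IsSymmetric.not_isSpecial_of_isDirectReturn {n : ℕ} (hn : N ≤ n) {i d : ℕ}
    (h : IsDirectReturn G u n i d) : ¬ IsSpecial u (factor u i n) := by
  intro hsp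
  obtain ⟨l, h1, h2, Θ, h3, h4, h5⟩ :=
    hS.exists_antimorphism_of_isSpecial (hT n hn).2.1 (hT n hn).2.2 h.1 hsp
  refine h.2 Θ h3 h4 ?_
  have := hS.apply_factor_of_isAntimorphism h3 h4 h5 0 n l (by omega)
  rwa [add_zero, show i + (d - l) + l = i + d by omega] at this

/-- Since its prefix and suffix of length `n` are not special, a direct return extends uniquely by
one letter on both sides. -/
theorem IsSymmetric.isDirectReturn_extend {n : ℕ} (hn : N ≤ n) {i d : ℕ}
    (h : IsDirectReturn G u n (i + 1) d) : IsDirectReturn G u (n + 2) i d := by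
  have hns := hS.not_isSpecial_of_isDirectReturn hT hn h
  obtain ⟨μ, hμ, hm, e⟩ := hS.exists_morphism_of_isDirectReturn h
  obtain ⟨⟨h1, h2, h3⟩, h4⟩ := h
  have hns' : ¬ IsSpecial u (factor u (i + d + 1) n) := fun hsp =>
    hns (hS.isSpecial_of_cls_eq (by rw [show i + d + 1 = i + 1 + d by omega, h2]) hsp)
  obtain ⟨j, hj⟩ := hS.exists_apply_factor hμ i (n + 2)
  have hj' := hS.apply_factor_of_isMorphism hμ hm hj 1 n (by omega)
  rw [e, show i + 1 + d = i + d + 1 by omega] at hj'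
  have hr := factor_succ_eq_of_not_isSpecial hns' hj'
  have hl := factor_succ_eq_of_not_isSpecial' hns' hj'
  have heq : factor u (i + d) (n + 2) = factor u j (n + 2) := by
    rw [factor_succ', factor_succ' u j, hr]
    rw [factor_succ', factor_succ' u j] at hl
    rw [(List.cons.inj hl).1]
  refine ⟨⟨by omega, (cls_eq_of_apply_eq hμ (hj.trans heq.symm)).symm, fun t ht1 ht2 ht => ?_⟩,
    fun Θ hΘ ha h => ?_⟩
  · obtain ⟨ν, hν, e'⟩ := orbit_eq_iff.1 ht.symm
    refine h3 (t + 1) (by omega) (by omega) (cls_eq_of_apply_eq hν ?_).symm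
    rcases hS.morphism_or_antimorphism ν hν with hm' | hm'
    · exact hS.apply_factor_of_isMorphism hν hm' e' 1 n (by omega)
    · exact hS.apply_factor_of_isAntimorphism hν hm' e' 1 n 1 (by omega)
  · have := hS.apply_factor_of_isAntimorphism hΘ ha h 1 n 1 (by omega)
    exact h4 Θ hΘ ha (by rw [this, show i + d + 1 = i + 1 + d by omega])

theorem IsSymmetric.isDirectReturn_extend_iterate {n : ℕ} (hn : N ≤ n) {i d : ℕ} (k : ℕ)
    (h : IsDirectReturn G u n (i + k) d) : IsDirectReturn G u (n + 2 * k) i d := by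
  induction k generalizing n with
  | zero => exact h
  | succ k ih =>
    have := ih (n := n + 2) (by omega) (hS.isDirectReturn_extend hT hn h)
    rwa [show n + 2 + 2 * k = n + 2 * (k + 1) by ring] at this

/-- A direct return is followed by its image under a morphism of `G`. -/
theorem IsSymmetric.exists_morphism_shift {n : ℕ} (hn : N ≤ n) {i d : ℕ}
    (h : IsDirectReturn G u n i d) :
    ∃ ν ∈ G, IsMorphism ν ∧ ν (factor u i (d + n)) = factor u (i + d) (d + n) := by
  -- A later occurrence leaves room for the extension by `d` letters to the left.
  obtain ⟨j, hj1, hj2⟩ := hS.recurrent i (d + (d + n)) d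
  obtain ⟨j, rfl⟩ := Nat.exists_eq_add_of_le' hj1
  have e0 : factor u (j + d) (d + n) = factor u i (d + n) :=
    factor_eq_of_factor_eq hj2 0 (d + n) (by omega)
  have e1 : factor u (j + d + d) (d + n) = factor u (i + d) (d + n) :=
    factor_eq_of_factor_eq hj2 d (d + n) (by omega)
  have hj := hS.isDirectReturn_map h G.one_mem (fun _ _ => rfl) e0.symm
  obtain ⟨ν, hν, hm, e⟩ := hS.exists_morphism_of_isDirectReturn
    (hS.isDirectReturn_extend_iterate hT hn d hj)
  refine ⟨ν, hν, hm, ?_⟩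
  rw [← e0, ← e1]
  exact hS.apply_factor_of_isMorphism hν hm e d (d + n) (by omega)

/-- There are no direct returns: after a direct return the word `u` runs through images of its
prefix under morphisms only, at equal distances, so that no image of the prefix under an
antimorphism could occur elsewhere. -/
theorem IsSymmetric.not_isDirectReturn {n : ℕ} (hn : N ≤ n) {i d : ℕ} :
    ¬ IsDirectReturn G u n i d := by
  intro h
  have key (m : ℕ) : IsDirectReturn G u n (i + d * m) d ∧
      ∃ ν ∈ G, IsMorphism ν ∧ ν (factor u i n) = factor u (i + d * m) n := by
    induction m with
    | zero => exact ⟨h, 1, G.one_mem, fun _ _ => rfl, rfl⟩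
    | succ m ih =>
      obtain ⟨h1, ν, hν, hm, e⟩ := ih
      obtain ⟨μ, hμ, hm', e'⟩ := hS.exists_morphism_shift hT hn h1
      rw [add_assoc, ← Nat.mul_succ] at e'
      refine ⟨hS.isDirectReturn_map h1 hμ hm' e', μ * ν, G.mul_mem hμ hν, hm'.mul hm, ?_⟩
      rw [Equiv.Perm.mul_apply, e]
      exact hS.apply_factor_of_isMorphism hμ hm' e' 0 n (by omega)
  obtain ⟨Θ, hΘ, ha⟩ := hS.exists_antimorphism
  obtain ⟨l, hl⟩ := hS.exists_apply_factor hΘ i n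
  obtain ⟨l', h1, h2⟩ := hS.recurrent l n i
  obtain ⟨q, rfl⟩ := Nat.exists_eq_add_of_le h1
  have hd : 0 < d := by have := h.1.1; omega
  obtain ⟨h3, ν, hν, hm, e⟩ := key (q / d)
  have hq : q = d * (q / d) + q % d := (Nat.div_add_mod q d).symm
  have hlt := Nat.mod_lt q hd
  have hcls : cls G u n (i + q) = cls G u n i :=
    (cls_eq_of_apply_eq hΘ (hl.trans h2.symm)).symm
  have hmod : q % d = 0 := by
    by_contra hc
    refine h3.1.2.2 (i + q) (by omega) (by omega) (hcls.trans ?_)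
    exact cls_eq_of_apply_eq hν e
  have hq' : i + d * (q / d) = i + q := by omega
  obtain ⟨μ, hμ, hm', e'⟩ := hS.exists_morphism_of_isDirectReturn h
  refine h.2 (μ * (ν⁻¹ * Θ)) (G.mul_mem hμ (G.mul_mem (G.inv_mem hν) hΘ))
    (hm'.mul_antimorphism (hm.inv.mul_antimorphism ha)) ?_
  rw [hq', h2, ← hl] at e
  rw [Equiv.Perm.mul_apply, Equiv.Perm.mul_apply, ← e, Equiv.Perm.inv_def,
    Equiv.symm_apply_apply, e']

theorem IsSymmetric.palindromicReturns_of_propertyTls {n : ℕ} (hn : N ≤ n) :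
    PalindromicReturns G u n := fun i d hret => by
  refine hS.isPalindrome_of_exists_antimorphism hT hn hret ?_
  by_contra hc
  push Not at hc
  exact hS.not_isDirectReturn hT hn ⟨hret, hc⟩

end

/-! ### Longest palindromic suffixes and complete return words -/

theorem isSuffix_factor_iff {x : List A} {i m : ℕ} :
    x <:+ factor u i m ↔ ∃ k, k ≤ m ∧ x = factor u (i + k) (m - k) := by
  constructor
  · rintro ⟨s, hs⟩
    have hm : s.length + x.length = m := by simpa using congrArg List.length hs
    refine ⟨s.length, by omega, ?_⟩
    rw [show m - s.length = x.length by omega]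
    exact eq_factor_of_append_eq (t := []) (by simpa using hs.symm)
  · rintro ⟨k, hk, rfl⟩
    refine ⟨factor u i k, ?_⟩
    rw [← factor_add, Nat.add_sub_cancel' hk]

theorem getLast?_factor (u : ℕ → A) (i m : ℕ) :
    (factor u i (m + 1)).getLast? = some (u (i + m)) := by
  rw [factor_add, factor_one, List.getLast?_append]
  simp

/-- If the suffix of length `n` of a factor has an earlier `G`-occurrence, then the complete
`G`-return word at the end of the factor is a `G`-palindromic suffix longer than `n`. -/
theorem exists_isPalindrome_suffix {n : ℕ} (hR : PalindromicReturns G u n) {i q k : ℕ}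
    (hk : k < q) (h : cls G u n (i + k) = cls G u n (i + q)) :
    ∃ l, l < q ∧ IsPalindrome G (factor u (i + l) (q + n - l)) := by
  obtain ⟨l, h1, h2, h3, h4⟩ := exists_prev (P := fun t => cls G u n t = cls G u n (i + q))
    (show i + k < i + q by omega) h
  obtain ⟨l, rfl⟩ := Nat.exists_eq_add_of_le (show i ≤ l by omega)
  refine ⟨l, by omega, ?_⟩
  have := hR (i + l) (q - l) ⟨by omega, by rw [h3]; congr 1; omega, fun t ht1 ht2 => ?_⟩
  · rwa [show q + n - l = q - l + n by omega]
  · rw [h3]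
    exact h4 t ht1 (by omega)

section

variable (hS : IsSymmetric G u)
include hS

theorem IsSymmetric.isGOccurrence_factor_iff {i m j n k : ℕ} :
    IsGOccurrence G (factor u j n) (factor u i m) k ↔
      k + n ≤ m ∧ cls G u n (i + k) = cls G u n j := by
  constructor
  · rintro ⟨_, ⟨μ, hμ, rfl⟩, h⟩
    rw [isOccurrence_factor_iff, hS.length_apply hμ, length_factor] at h
    exact ⟨h.1, (cls_eq_of_apply_eq hμ h.2).symm⟩
  · rintro ⟨h1, h2⟩
    refine ⟨factor u (i + k) n, orbit_eq_iff.1 h2.symm |>.imp fun _ h => ⟨h.1, h.2.symm⟩, ?_⟩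
    rw [isOccurrence_factor_iff, length_factor]
    exact ⟨h1, rfl⟩

theorem IsSymmetric.isUnioccurrent_factor_iff {i m k : ℕ} (hk : k ≤ m) :
    IsUnioccurrent G (factor u (i + k) (m - k)) (factor u i m) ↔
      ∀ j, j ≤ k → cls G u (m - k) (i + j) = cls G u (m - k) (i + k) → j = k := by
  have hocc : IsOccurrence (factor u (i + k) (m - k)) (factor u i m) k :=
    isOccurrence_factor_iff.2 ⟨by simp; omega, by simp⟩
  constructor
  · rintro ⟨p, -, hp⟩ j hj h
    rw [hp j (hS.isGOccurrence_factor_iff.2 ⟨by omega, h⟩),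
      hp k ⟨_, mem_orbit_self _ _, hocc⟩]
  · intro h
    refine ⟨k, hocc, fun j hj => ?_⟩
    obtain ⟨h1, h2⟩ := hS.isGOccurrence_factor_iff.1 hj
    exact h j (by omega) h2

/-- A suffix no longer than `n` of a complete `G`-return word of a factor of length `n` also has a
`G`-occurrence in the prefix of length `n`. -/
theorem IsSymmetric.not_isUnioccurrent_of_isGReturn {n i d k : ℕ}
    (hret : IsGReturn G u n i (i + d)) (hdk : d ≤ k) (hk : k ≤ d + n) :
    ¬ IsUnioccurrent G (factor u (i + k) (d + n - k)) (factor u i (d + n)) := by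
  rw [hS.isUnioccurrent_factor_iff hk]
  intro h
  have hd := hret.1
  obtain ⟨μ, hμ, e⟩ := orbit_eq_iff.1 hret.2.1
  obtain ⟨a, rfl⟩ := Nat.exists_eq_add_of_le hdk
  rcases hS.morphism_or_antimorphism μ hμ with hm | hm
  · have h1 := hS.apply_factor_of_isMorphism hμ hm e a (d + n - (d + a)) (by omega)
    rw [add_assoc] at h1
    have := h a (by omega) (cls_eq_of_apply_eq hμ h1).symm
    omega
  · have h1 := hS.apply_factor_of_isAntimorphism hμ hm e a (d + n - (d + a)) 0 (by omega)
    rw [add_assoc] at h1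
    have := h 0 (by omega) (cls_eq_of_apply_eq hμ h1).symm
    omega

theorem IsSymmetric.palindromicReturns_of_propertyLps {N : ℕ} (hL : PropertyLps G u N) {n : ℕ}
    (hn : N ≤ n) (hn1 : 1 ≤ n) : PalindromicReturns G u n := by
  intro i d hret
  have hd := hret.1
  rcases hL (factor u i (d + n)) (factor_mem_language _ _ _) (by simp; omega) with
    ⟨x, ⟨hx1, hx2, -⟩, hx3⟩ | ⟨a, ha, hu⟩
  · obtain ⟨k, hk, rfl⟩ := isSuffix_factor_iff.1 hx1
    rcases Nat.eq_zero_or_pos k with rfl | hk0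
    · exact hx2
    rcases le_or_gt d k with hdk | hdk
    · exact absurd hx3 (hS.not_isUnioccurrent_of_isGReturn hret hdk hk)
    · -- The suffix is longer than `n`, so by symmetry the class of length `n` occurs at `k`.
      obtain ⟨b, rfl⟩ := Nat.exists_eq_add_of_le hdk.le
      rw [show k + b + n - k = b + n by omega] at hx2
      have := hS.cls_reflect (a := 0) (b := b) hx2 (by omega)
      rw [add_zero, add_assoc, hret.2.1] at this
      exact absurd this (hret.2.2 _ (by omega) (by omega))
  · obtain ⟨n, rfl⟩ := Nat.exists_eq_add_of_le' hn1
    rw [← add_assoc, getLast?_factor, Option.some.injEq] at ha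
    subst ha
    have := hS.not_isUnioccurrent_of_isGReturn hret (k := d + n) (by omega) (by omega)
    rw [show d + (n + 1) - (d + n) = 1 by omega, factor_one] at this
    exact absurd hu this

/-- If the longest `G`-palindromic suffix is long enough, then it is `G`-unioccurrent: the complete
`G`-return word between its last two `G`-occurrences would be a longer `G`-palindromic suffix. -/
theorem IsSymmetric.exists_isLongestPalindromicSuffix {N : ℕ}
    (hR : ∀ n, N ≤ n → PalindromicReturns G u n) {i m l : ℕ} (hl : l + N ≤ m)
    (h : IsPalindrome G (factor u (i + l) (m - l))) :
    ∃ x, IsLongestPalindromicSuffix G (factor u i m) x ∧ IsUnioccurrent G x (factor u i m) := by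
  classical
  have hex : ∃ l, IsPalindrome G (factor u (i + l) (m - l)) := ⟨l, h⟩
  obtain ⟨k, hk1, hk2⟩ : ∃ k, IsPalindrome G (factor u (i + k) (m - k)) ∧
      ∀ l, IsPalindrome G (factor u (i + l) (m - l)) → k ≤ l :=
    ⟨Nat.find hex, Nat.find_spec hex, fun l hl => Nat.find_min' hex hl⟩
  have hkl := hk2 l h
  refine ⟨factor u (i + k) (m - k), ⟨isSuffix_factor_iff.2 ⟨k, by omega, rfl⟩, hk1, ?_⟩, ?_⟩
  · intro x hx hpal
    obtain ⟨l, hl, rfl⟩ := isSuffix_factor_iff.1 hx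
    have := hk2 l hpal
    simp only [length_factor]
    omega
  · rw [hS.isUnioccurrent_factor_iff (by omega)]
    intro j hj hc
    by_contra hne
    obtain ⟨r, h1, h2⟩ := exists_isPalindrome_suffix (hR (m - k) (by omega))
      (show j < k by omega) hc
    rw [show k + (m - k) - r = m - r by omega] at h2
    have := hk2 r h2
    omega

theorem IsSymmetric.propertyLps_one (hR : ∀ n, 1 ≤ n → PalindromicReturns G u n) :
    PropertyLps G u 1 := by
  intro v hv hlen
  obtain ⟨i, hi⟩ := exists_eq_factor hv
  obtain ⟨m, hm⟩ := Nat.exists_eq_add_of_le' hlen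
  rw [hm] at hi
  subst hi
  by_cases h : ∃ k, k < m ∧ cls G u 1 (i + k) = cls G u 1 (i + m)
  · obtain ⟨k, hk, hc⟩ := h
    obtain ⟨l, hl, hpal⟩ := exists_isPalindrome_suffix (hR 1 le_rfl) hk hc
    exact Or.inl (hS.exists_isLongestPalindromicSuffix hR (by omega) hpal)
  · push Not at h
    refine Or.inr ⟨u (i + m), getLast?_factor u i m, ?_⟩
    have := hS.isUnioccurrent_factor_iff (i := i) (m := m + 1) (k := m) (by omega)
    rw [show m + 1 - m = 1 by omega, factor_one] at this
    refine this.2 fun j hj hc => ?_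
    by_contra hne
    exact h j (by omega) hc

/-- In a uniformly recurrent word the gaps between consecutive occurrences of a factor of length
`n` are bounded. -/
theorem IsSymmetric.exists_gap_bound [Finite A] (hU : IsUniformlyRecurrent u) (n : ℕ) :
    ∃ M, ∀ i q, M < q → ∃ k, k < q ∧ factor u (i + k) n = factor u (i + q) n := by
  have h1 (w : List A) : ∃ M, w ∈ language u → ∀ q, IsReturnWord u w q → q.length ≤ M := by
    by_cases hw : w ∈ language u
    · obtain ⟨M, hM⟩ := ((hU w hw).image List.length).bddAbove
      exact ⟨M, fun _ q hq => hM ⟨q, hq, rfl⟩⟩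
    · exact ⟨0, fun h => absurd h hw⟩
  choose B hB using h1
  obtain ⟨M, hM⟩ := ((List.finite_length_eq A n).image B).bddAbove
  refine ⟨M, fun i q hq => ?_⟩
  -- A later occurrence of `u[i, i + q + n)` guarantees that its suffix of length `n` has an
  -- earlier occurrence in `u`.
  obtain ⟨j, hj1, hj2⟩ := hS.recurrent i (q + n) (i + q + 1)
  have hjq : factor u (j + q) n = factor u (i + q) n := factor_eq_of_factor_eq hj2 q n le_rfl
  obtain ⟨l, h1, h2, h3, h4⟩ :=
    exists_prev (P := fun t => factor u t n = factor u (i + q) n)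
      (show i + q < j + q by omega) rfl
  obtain ⟨g, hg⟩ := Nat.exists_eq_add_of_lt h2
  have hret : IsReturnWord u (factor u (i + q) n) (factor u l (g + 1)) := by
    have e : factor u l (g + 1) ++ factor u (i + q) n = factor u l (g + 1 + n) := by
      rw [factor_add u l (g + 1) n, ← hjq, hg, add_assoc]
    rw [IsReturnWord, IsCompleteReturnWord, e]
    refine ⟨factor_mem_language _ _ _, by simp, fun t => ?_⟩
    rw [isOccurrence_factor_iff]
    simp only [length_factor, Nat.add_sub_cancel]
    constructor
    · rintro ⟨h5, h6⟩
      by_contra hc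
      exact h4 (l + t) (by omega) (by omega) h6.symm
    · rintro (rfl | rfl)
      · exact ⟨by omega, h3.symm⟩
      · exact ⟨le_rfl, by rw [← add_assoc, ← hg, hjq]⟩
  have hle : g + 1 ≤ M := by
    have h5 := hB _ (factor_mem_language u (i + q) n) _ hret
    have h6 : B (factor u (i + q) n) ≤ M := hM ⟨_, length_factor _ _ _, rfl⟩
    rw [length_factor] at h5
    omega
  obtain ⟨k, rfl⟩ := Nat.exists_eq_add_of_le (show j ≤ l by omega)
  refine ⟨k, by omega, ?_⟩
  rw [← h3]
  exact (factor_eq_of_factor_eq hj2 k n (by omega)).symm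

theorem IsSymmetric.exists_propertyLps [Finite A] (hU : IsUniformlyRecurrent u) {N : ℕ}
    (hR : ∀ n, N ≤ n → PalindromicReturns G u n) : ∃ N', PropertyLps G u N' := by
  obtain ⟨M, hM⟩ := hS.exists_gap_bound hU N
  refine ⟨M + 1 + N, fun v hv hlen => Or.inl ?_⟩
  obtain ⟨i, hi⟩ := exists_eq_factor hv
  obtain ⟨q, hq⟩ := Nat.exists_eq_add_of_le' (show N ≤ v.length by omega)
  rw [hq] at hi hlen
  subst hi
  obtain ⟨k, hk, e⟩ := hM i q (by omega)
  obtain ⟨l, hl, hpal⟩ :=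
    exists_isPalindrome_suffix (hR N le_rfl) hk (cls_eq_of_factor_eq e)
  exact hS.exists_isLongestPalindromicSuffix hR (by omega) hpal

end

end GRich

theorem mainTheorem2 {A : Type*} [Finite A]
    (G : Subgroup (Equiv.Perm (List A))) (hfin : Finite G)
    (hG : ∀ μ ∈ G, GRich.IsMorphism μ ∨ GRich.IsAntimorphism μ)
    (hanti : ∃ Θ ∈ G, GRich.IsAntimorphism Θ)
    (u : ℕ → A) (hu : GRich.IsClosedUnder G u) :
    (GRich.IsRich G u ↔ GRich.PropertyLps G u 1) ∧
    (GRich.IsUniformlyRecurrent u →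
      (GRich.IsAlmostRich G u ↔ ∃ N : ℕ, GRich.PropertyLps G u N)) := by
  have hS : GRich.IsSymmetric G u := ⟨hG, hanti, hu⟩
  refine ⟨⟨fun hT => ?_, fun hL => ?_⟩, fun hU => ⟨?_, ?_⟩⟩
  · exact hS.propertyLps_one fun n hn => hS.palindromicReturns_of_propertyTls hT hn
  · exact hS.propertyTls_of_palindromicReturns fun n hn =>
      hS.palindromicReturns_of_propertyLps hL hn hn
  · rintro ⟨N, hT⟩
    exact hS.exists_propertyLps hU fun n hn => hS.palindromicReturns_of_propertyTls hT hn
  · rintro ⟨N, hL⟩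
    -- Complete `G`-return words of the empty word are single letters, which need not be
    -- `G`-palindromes; so the order `0` is left out.
    exact ⟨max N 1, hS.propertyTls_of_palindromicReturns fun n hn =>
      hS.palindromicReturns_of_propertyLps hL (le_of_max_le_left hn) (le_of_max_le_right hn)⟩
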